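/- **Theorem 1.6.** Let $X_1,\dots,X_n$ be real observations. Under $H_0$ they are i.i.d. $N(0,1)$. Under $H_1^{(n)}$ they are i.i.d. from $(1-\varepsilon_n)N(0,1)+\varepsilon_nN(\mu_n,1)$, where $\varepsilon_n=n^{-\beta}$, $\mu_n=\sqrt{2r\log n}$, $\frac12<\beta<1$ and $r>0$. Let $p_i=P\{N(0,1)>X_i\}$, let $p_{(1)}\le\dots\le p_{(n)}$ be the sorted $p$-values, and define $$\mathrm{BJ}_n^+=n\max_{1\le i\le n/2}K^+(i/n,p_{(i)}),\qquad K^+(t,x)=\begin{cases}t\log\frac tx+(1-t)\log\frac{1-t}{1-x},&0<x<t<1,\\0,&0\le t\le x\le1,\\+\infty,&\text{otherwise.}\end{cases}$$ The Berk–Jones test of level $\alpha_n\in(0,1)$ rejects $H_0$ when $\mathrm{BJ}_n^+>b_n$, where $b_n$ is a critical value, i.e. $P_{H_0}\{\mathrm{BJ}_n^+>b_n\}\le\alpha_n$. Say that the levels tend to $0$ slowly enough, with critical values $b_n$, if $\alpha_n\to0$ and $b_n=(1+o(1))\log\log n$. Let $$\rho^*(\beta)=\begin{cases}\beta-\frac12,&\frac12<\beta\le\frac34,\\(1-\sqrt{1-\beta})^2,&\frac34<\beta<1.\end{cases}$$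 Then levels tending to $0$ slowly enough, with corresponding critical values, exist. Moreover, for every $\beta\in(\frac12,1)$, the detection boundary $\rho_{\mathrm{BJ}}(\beta)$ of the Berk–Jones test exists, is unique and equals $\rho^*(\beta)$; that is, $\rho=\rho^*(\beta)$ is the only real number such that, for all levels $\alpha_n$ tending to $0$ slowly enough with critical values $b_n$ and all $r>0$, $$P_{H_1^{(n)}}\{\mathrm{BJ}_n^+>b_n\}\to1\ \text{ if } r>\rho,\qquad P_{H_1^{(n)}}\{\mathrm{BJ}_n^+>b_n\}\to0\ \text{ if } r<\rho\qquad(n\to\infty).$$ -/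

import Mathlib

open MeasureTheory ProbabilityTheory Filter Topology

namespace BerkJones

noncomputable section

/-- The law of the data `(X₁, …, Xₙ)` under the global null hypothesis:
i.i.d. standard normal observations. -/
def nullLaw (n : ℕ) : Measure (Fin n → ℝ) :=
  Measure.pi fun _ => gaussianReal 0 1

/-- The two-component normal mixture `(1 - ε) N(0, 1) + ε N(μ, 1)`, for `0 ≤ ε ≤ 1`. -/
def mixture (ε μ : ℝ) : Measure ℝ :=
  ENNReal.ofReal (1 - ε) • gaussianReal 0 1 + ENNReal.ofReal ε • gaussianReal μ 1

/-- The law of the data `(X₁, …, Xₙ)` under the alternative: i.i.d. observations from the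
mixture with `εₙ = n ^ (-β)` and `μₙ = √(2 r log n)`. -/
def altLaw (β r : ℝ) (n : ℕ) : Measure (Fin n → ℝ) :=
  Measure.pi fun _ => mixture ((n : ℝ) ^ (-β)) (Real.sqrt (2 * r * Real.log n))

/-- The p-value `P{N(0, 1) > x}` of an observation `x`. -/
def pValue (x : ℝ) : ℝ := (gaussianReal 0 1).real (Set.Ioi x)

/-- The order statistics `p₍₁₎ ≤ … ≤ p₍ₙ₎` of `p`; as `Fin n` starts at `0`,
the value at `i` is `p₍ᵢ₊₁₎`. -/
def orderStat {n : ℕ} (p : Fin n → ℝ) (i : Fin n) : ℝ := p (Tuple.sort p i)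

open Classical in
/-- The function `K⁺(t, x)`, with values in the extended real numbers. -/
def kPlus (t x : ℝ) : EReal :=
  if 0 < x ∧ x < t ∧ t < 1 then
    ((t * Real.log (t / x) + (1 - t) * Real.log ((1 - t) / (1 - x)) : ℝ) : EReal)
  else if 0 ≤ t ∧ t ≤ x ∧ x ≤ 1 then 0
  else ⊤

/-- The Berk–Jones statistic `n · max_{1 ≤ i ≤ n/2} K⁺(i/n, p₍ᵢ₎)` of the data `X`.
The index `i : Fin n` stands for `i + 1` in this formula.
For `n ≥ 2` the supremum is the maximum of a finite nonempty family. -/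
def bjStat {n : ℕ} (X : Fin n → ℝ) : EReal :=
  (n : EReal) * ⨆ (i : Fin n) (_ : ((i : ℝ) + 1) ≤ (n : ℝ) / 2),
    kPlus (((i : ℝ) + 1) / n) (orderStat (fun j => pValue (X j)) i)

/-- The event that the Berk–Jones test with critical value `b` rejects the null hypothesis. -/
def rejects (n : ℕ) (b : ℝ) : Set (Fin n → ℝ) := {X | (b : EReal) < bjStat X}

/-- `b` is a critical value for a level-`α` Berk–Jones test with `n` observations. -/
def IsCriticalValue (n : ℕ) (α b : ℝ) : Prop := (nullLaw n).real (rejects n b) ≤ α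

/-- The levels `αₙ` tend to `0` slowly enough, with critical values `bₙ`: the tests have
level `αₙ → 0` and `bₙ = (1 + o(1)) log log n`. -/
structure SlowlyEnough (α b : ℕ → ℝ) : Prop where
  level_mem : ∀ n, α n ∈ Set.Ioo (0 : ℝ) 1
  level_tendsto : Tendsto α atTop (𝓝 0)
  critical : ∀ n, IsCriticalValue n (α n) (b n)
  equivalent : Asymptotics.IsEquivalent atTop b fun n : ℕ => Real.log (Real.log n)

/-- The power of the Berk–Jones test with critical value `b` against the alternative. -/
def power (β r : ℝ) (n : ℕ) (b : ℝ) : ℝ := (altLaw β r n).real (rejects n b)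

/-- `ρ` is the detection boundary at `β` of the Berk–Jones test: whenever the levels tend to `0`
slowly enough, the power tends to `1` for every `r > ρ` and to `0` for every `r < ρ`
(where the amplitude parameter `r` is positive). -/
def IsDetectionBoundary (β ρ : ℝ) : Prop :=
  ∀ α b : ℕ → ℝ, SlowlyEnough α b → ∀ r : ℝ, 0 < r →
    (ρ < r → Tendsto (fun n => power β r n (b n)) atTop (𝓝 1)) ∧
    (r < ρ → Tendsto (fun n => power β r n (b n)) atTop (𝓝 0))

/-- The function `ρ*` on `(1/2, 1)`. -/
def rhoStar (β : ℝ) : ℝ :=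
  if β ≤ 3 / 4 then β - 1 / 2 else (1 - Real.sqrt (1 - β)) ^ 2

end

end BerkJones

/-! Write `T = √(2 log n)`: a normal tail beyond `σT` has mass `n^(-σ²)` up to lower order factors,
and `μₙ = wT` with `w = √r`. Three estimates carry the proof.

Level (`nullLaw_rejects_le`). Rejection means that, for some `i`, at least `i` p-values lie below
the point `ξᵢ < i/n` whose divergence from `i/n` is `b/n`. For a single `i` this has probability at
most `exp (-b)`, by tilting the uniform law. A union bound over all `i` would lose a factor of order
`n`. Instead one tilt serves all indices with nearly equal optimal tilts: splitting according to the
first threshold that is exceeded gives disjoint events, whose tilted probabilities sum to at most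
`1` (`pi_exists_count_ge_le`). Geometric classes of tilts, about `b (b + log n)` in number, cover
all indices, so `b = log log n + √(log log n)` already gives vanishing levels.

Below the boundary (`power_tendsto_zero`). The likelihood ratio truncated at `T` has bounded second
moment and the truncation costs `o(1)`, so any event of null probability `α` has probability at most
`c α + O(1/c) + o(1)` under the alternative.

Above the boundary (`power_tendsto_one`). Beyond `σT` the null law puts about `n^(1-σ²)`
observations and the mixture adds about `n^(1-β-u²)`, where `u = max (σ-w) 0`. By Chebyshev and the
quadratic lower bound for the divergence, the statistic exceeds a power of `n`, hence `log log n`,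
once `1-β-u² > (1-σ²)/2`. The best `σ` is `min (2w) 1`; its two cases produce the two branches of
`ρ*`.

Uniqueness: two boundaries would enclose an `r > 0` at which the power tends to both `0` and `1`. -/

namespace BerkJones

/-! ### The standard normal tail function -/

/-- The standard normal law charges every nondegenerate interval. -/
theorem gaussianReal_Ioc_pos {x y : ℝ} (h : x < y) : 0 < gaussianReal 0 1 (Set.Ioc x y) := by
  by_contra h0
  have h1 : gaussianReal 0 1 (Set.Ioc x y) = 0 := by simpa using h0
  have h2 := gaussianReal_absolutelyContinuous' 0 (one_ne_zero) h1
  simp [Real.volume_Ioc] at h2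
  linarith

theorem pValue_strictAnti : StrictAnti pValue := by
  intro x y h
  have : Set.Ioi x = Set.Ioc x y ∪ Set.Ioi y := (Set.Ioc_union_Ioi_eq_Ioi h.le).symm
  unfold pValue
  rw [this, measureReal_union (by
    rw [Set.disjoint_left]; intro z hz hz'; exact absurd hz.2 (not_le.mpr hz')) measurableSet_Ioi]
  have := ENNReal.toReal_pos (gaussianReal_Ioc_pos h).ne' (measure_ne_top _ _)
  rw [Measure.real, Measure.real]
  linarith

theorem pValue_eq_one_sub_cdf (x : ℝ) : pValue x = 1 - cdf (gaussianReal 0 1) x := by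
  rw [cdf_eq_real, pValue, ← Set.compl_Iic, probReal_compl_eq_one_sub measurableSet_Iic]

theorem pValue_pos (x : ℝ) : 0 < pValue x :=
  lt_of_le_of_lt measureReal_nonneg (pValue_strictAnti (show x < x + 1 by linarith))

theorem pValue_lt_one (x : ℝ) : pValue x < 1 :=
  lt_of_lt_of_le (pValue_strictAnti (show x - 1 < x by linarith)) measureReal_le_one

theorem measurable_pValue : Measurable pValue := pValue_strictAnti.antitone.measurable

theorem continuous_pValue : Continuous pValue := by
  have : pValue = fun x => 1 - cdf (gaussianReal 0 1) x := funext pValue_eq_one_sub_cdf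
  rw [this]
  refine continuous_const.sub ?_
  rw [continuous_iff_continuousAt]
  intro x
  -- The normal law has no atoms, so its distribution function has no jumps.
  have hs : (cdf (gaussianReal 0 1)).measure {x} = 0 := by
    rw [measure_cdf]
    have := nullSingletonClass_gaussianReal (μ := 0) (v := 1) one_ne_zero
    exact measure_singleton x
  rw [StieltjesFunction.measure_singleton] at hs
  have hle : (cdf (gaussianReal 0 1)) x ≤ Function.leftLim (cdf (gaussianReal 0 1)) x := by
    have := ENNReal.ofReal_eq_zero.mp hs
    linarith
  have heq := le_antisymm ((cdf (gaussianReal 0 1)).mono.leftLim_le le_rfl) hle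
  rw [(cdf (gaussianReal 0 1)).mono.continuousAt_iff_leftLim_eq_rightLim, heq,
    StieltjesFunction.rightLim_eq]

theorem exists_pValue_eq {x : ℝ} (hx0 : 0 < x) (hx1 : x < 1) : ∃ z, pValue z = x := by
  have hb : Tendsto pValue atBot (𝓝 1) := by
    simpa using ((tendsto_cdf_atBot (gaussianReal 0 1)).const_sub 1).congr
      fun z => (pValue_eq_one_sub_cdf z).symm
  have ht : Tendsto pValue atTop (𝓝 0) := by
    simpa using ((tendsto_cdf_atTop (gaussianReal 0 1)).const_sub 1).congr
      fun z => (pValue_eq_one_sub_cdf z).symm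
  obtain ⟨y, hy⟩ := (hb.eventually (lt_mem_nhds hx1)).exists
  obtain ⟨z, hz⟩ := (ht.eventually (gt_mem_nhds hx0)).exists
  exact mem_range_of_exists_le_of_exists_ge continuous_pValue ⟨z, hz.le⟩ ⟨y, hy.le⟩

/-- p-values are uniformly distributed under the null hypothesis. -/
theorem gaussianReal_pValue_lt {x : ℝ} (hx0 : 0 < x) (hx1 : x < 1) :
    gaussianReal 0 1 {u | pValue u < x} = ENNReal.ofReal x := by
  obtain ⟨z, rfl⟩ := exists_pValue_eq hx0 hx1
  have : {u | pValue u < pValue z} = Set.Ioi z := by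
    ext u; exact pValue_strictAnti.lt_iff_gt
  rw [this, pValue, ofReal_measureReal]

theorem gaussianReal_real_Ioi (m y : ℝ) : (gaussianReal m 1).real (Set.Ioi y) = pValue (y - m) := by
  have h : gaussianReal m 1 = (gaussianReal 0 1).map (· + m) := by
    rw [gaussianReal_map_add_const]; simp
  rw [h, map_measureReal_apply (by fun_prop) measurableSet_Ioi, pValue]
  congr 1
  ext u
  simp [sub_lt_iff_lt_add]

theorem gaussianReal_real_Iic (m y : ℝ) : (gaussianReal m 1).real (Set.Iic y) = pValue (m - y) := by
  have h : gaussianReal m 1 = (gaussianReal 0 1).map (fun x => m - x) := by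
    rw [gaussianReal_map_const_sub]; simp
  rw [h, map_measureReal_apply (by fun_prop) measurableSet_Iic, pValue]
  have : (fun x => m - x) ⁻¹' Set.Iic y = Set.Ici (m - y) := by
    ext u; simp
  rw [this]
  have := nullSingletonClass_gaussianReal (μ := 0) (v := 1) one_ne_zero
  exact measureReal_congr Ioi_ae_eq_Ici.symm

/-! ### Gaussian likelihood ratios and tail bounds -/

theorem gaussianReal_eq_withDensity (m : ℝ) :
    gaussianReal m 1 =
      (gaussianReal 0 1).withDensity fun x => ENNReal.ofReal (Real.exp (m * x - m ^ 2 / 2)) := by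
  rw [gaussianReal_of_var_ne_zero _ one_ne_zero, gaussianReal_of_var_ne_zero _ one_ne_zero,
    ← withDensity_mul _ (measurable_gaussianPDF 0 1) (by fun_prop)]
  congr 1
  ext x
  simp only [Pi.mul_apply, gaussianPDF]
  rw [← ENNReal.ofReal_mul (gaussianPDFReal_nonneg _ _ _)]
  congr 1
  simp only [gaussianPDFReal]
  rw [mul_assoc _ (Real.exp _), ← Real.exp_add]
  congr 2
  push_cast
  ring

theorem pValue_eq_integral (y : ℝ) : pValue y = ∫ x in Set.Ioi y, gaussianPDFReal 0 1 x := by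
  rw [pValue, Measure.real, gaussianReal_apply_eq_integral _ one_ne_zero, ENNReal.toReal_ofReal]
  exact integral_nonneg fun x => gaussianPDFReal_nonneg _ _ _

theorem gaussianPDFReal_zero_one (x : ℝ) :
    gaussianPDFReal 0 1 x = (√(2 * Real.pi))⁻¹ * Real.exp (-x ^ 2 / 2) := by
  simp [gaussianPDFReal]

/-- Mills' upper bound, without the sharp constant. -/
theorem pValue_le {y : ℝ} (hy : 0 < y) : pValue y ≤ Real.exp (-y ^ 2 / 2) / y := by
  -- For `x > y` the density is at most `x / y * exp (-x² / 2)`, which has an explicit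
  -- antiderivative.
  have hd : ∀ x ∈ Set.Ici y, HasDerivAt (fun x => -(Real.exp (-x ^ 2 / 2) / y))
      (x / y * Real.exp (-x ^ 2 / 2)) x := by
    intro x _
    have h := ((((hasDerivAt_pow 2 x).neg).div_const 2).exp.div_const y).neg
    refine h.congr_deriv ?_
    simp only [Pi.neg_apply]
    push_cast
    ring
  have hlim : Tendsto (fun x : ℝ => -(Real.exp (-x ^ 2 / 2) / y)) atTop (𝓝 0) := by
    have h1 : Tendsto (fun x : ℝ => -x ^ 2 / 2) atTop atBot := by
      have : Tendsto (fun x : ℝ => x ^ 2 / 2) atTop atTop :=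
        (tendsto_pow_atTop two_ne_zero).atTop_div_const two_pos
      exact (tendsto_neg_atTop_atBot.comp this).congr fun x => (neg_div _ _).symm
    simpa using ((Real.tendsto_exp_atBot.comp h1).div_const y).neg
  have hpos : ∀ x ∈ Set.Ioi y, 0 ≤ x / y * Real.exp (-x ^ 2 / 2) := fun x hx => by
    have : 0 < x := hy.trans hx
    positivity
  have hint := integrableOn_Ioi_deriv_of_nonneg' hd hpos hlim
  have hval := integral_Ioi_of_hasDerivAt_of_nonneg' hd hpos hlim
  rw [pValue_eq_integral]
  calc ∫ x in Set.Ioi y, gaussianPDFReal 0 1 x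
      ≤ ∫ x in Set.Ioi y, x / y * Real.exp (-x ^ 2 / 2) := by
        refine setIntegral_mono_on (integrable_gaussianPDFReal 0 1).integrableOn hint
          measurableSet_Ioi fun x hx => ?_
        rw [gaussianPDFReal_zero_one]
        have h1 : (√(2 * Real.pi))⁻¹ ≤ 1 := by
          refine inv_le_one_of_one_le₀ (Real.one_le_sqrt.mpr ?_)
          nlinarith [Real.pi_gt_three]
        have h2 : 1 ≤ x / y := (one_le_div hy).mpr (le_of_lt hx)
        gcongr
        exact h1.trans h2
    _ = Real.exp (-y ^ 2 / 2) / y := by rw [hval]; ring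

/-- On `(y, y + 1]` the density is at least its value at `y + 1`. The loss is a factor `exp (-y -
1/2)`, harmless on the polynomial scale in `n`. -/
theorem le_pValue {y : ℝ} (hy : 0 ≤ y) :
    (√(2 * Real.pi))⁻¹ * Real.exp (-(y + 1) ^ 2 / 2) ≤ pValue y := by
  have hi := (integrable_gaussianPDFReal 0 1)
  rw [pValue_eq_integral]
  calc (√(2 * Real.pi))⁻¹ * Real.exp (-(y + 1) ^ 2 / 2)
      = ∫ _x in Set.Ioc y (y + 1), (√(2 * Real.pi))⁻¹ * Real.exp (-(y + 1) ^ 2 / 2) := by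
        simp
    _ ≤ ∫ x in Set.Ioc y (y + 1), gaussianPDFReal 0 1 x := by
        refine setIntegral_mono_on (integrableOn_const (by simp)) hi.integrableOn measurableSet_Ioc fun x hx => ?_
        rw [gaussianPDFReal_zero_one]
        have : 0 ≤ x := hy.trans hx.1.le
        gcongr
        exact hx.2
    _ ≤ ∫ x in Set.Ioi y, gaussianPDFReal 0 1 x :=
        setIntegral_mono_set hi.integrableOn
          (ae_of_all _ fun x => gaussianPDFReal_nonneg _ _ _)
          (Set.Ioc_subset_Ioi_self.eventuallyLE)

/-! ### Product measures -/

/-- Lebesgue integrals of product functions factor. -/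
theorem lintegral_pi_prod {Ω : Type*} [MeasurableSpace Ω] {n : ℕ} (μ : Measure Ω)
    [IsProbabilityMeasure μ] {f : Fin n → Ω → ENNReal} (hf : ∀ j, Measurable (f j)) :
    ∫⁻ x, ∏ j, f j (x j) ∂(Measure.pi fun _ : Fin n => μ) = ∏ j, ∫⁻ u, f j u ∂μ := by
  have h := lintegral_prod_eq_prod_lintegral_of_indepFun (μ := Measure.pi fun _ : Fin n => μ)
    Finset.univ (fun j x => f j (x j)) (iIndepFun_pi fun j => (hf j).aemeasurable)
    fun j => (hf j).comp (measurable_pi_apply j)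
  rw [h]
  refine Finset.prod_congr rfl fun j _ => ?_
  exact (measurePreserving_eval (fun _ : Fin n => μ) j).lintegral_comp (hf j)

/-- A product of measures with densities has the product density. -/
theorem pi_withDensity {Ω : Type*} [MeasurableSpace Ω] {n : ℕ} (μ : Measure Ω)
    [IsProbabilityMeasure μ] {f : Ω → ENNReal} (hf : Measurable f)
    [SigmaFinite (μ.withDensity f)] :
    (Measure.pi fun _ : Fin n => μ.withDensity f) =
      (Measure.pi fun _ : Fin n => μ).withDensity fun x => ∏ j, f (x j) := by
  refine Measure.pi_eq (μ := fun _ : Fin n => μ.withDensity f) (μ' := (Measure.pi fun _ => μ).withDensity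
    fun x => ∏ j, f (x j)) ?_
  intro s hs
  rw [withDensity_apply _ (MeasurableSet.univ_pi hs),
    ← lintegral_indicator (MeasurableSet.univ_pi hs)]
  have h : ∀ x : Fin n → Ω, (Set.univ.pi s).indicator (fun x => ∏ j, f (x j)) x
      = ∏ j, (s j).indicator f (x j) := by
    intro x
    by_cases hx : x ∈ Set.univ.pi s
    · rw [Set.indicator_of_mem hx]
      exact Finset.prod_congr rfl fun j _ =>
        (Set.indicator_of_mem (hx j (Set.mem_univ j)) f).symm
    · rw [Set.indicator_of_notMem hx]
      obtain ⟨j, hj⟩ : ∃ j, x j ∉ s j := by simpa [Set.mem_pi] using hx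
      exact (Finset.prod_eq_zero (Finset.mem_univ j) (Set.indicator_of_notMem hj f)).symm
  simp_rw [h]
  rw [lintegral_pi_prod μ fun j => hf.indicator (hs j)]
  exact Finset.prod_congr rfl fun j _ => by
    rw [lintegral_indicator (hs j), withDensity_apply _ (hs j)]

/-! ### Estimates for the Bernoulli relative entropy -/

/-- The relative entropy of the Bernoulli law with parameter `t` with respect to that with
parameter `x`, for `t, x ∈ (0, 1)`. -/
noncomputable def bernoulliKL (t x : ℝ) : ℝ :=
  t * Real.log (t / x) + (1 - t) * Real.log ((1 - t) / (1 - x))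

theorem sub_le_mul_log_div {t x : ℝ} (ht : 0 < t) (hx : 0 < x) : t - x ≤ t * Real.log (t / x) := by
  have h := Real.one_sub_inv_le_log_of_pos (div_pos ht hx)
  rw [inv_div] at h
  calc t - x = t * (1 - x / t) := by field_simp
    _ ≤ _ := by gcongr

theorem le_bernoulliKL {t x : ℝ} (hxt : x < t) (ht : t < 1) :
    t * Real.log (t / x) - (t - x) ≤ bernoulliKL t x := by
  have := sub_le_mul_log_div (t := 1 - t) (x := 1 - x) (by linarith) (by linarith)
  unfold bernoulliKL
  linarith

theorem add_sq_div_two_le_neg_log {w : ℝ} (h0 : 0 ≤ w) (h1 : w < 1) :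
    w + w ^ 2 / 2 ≤ -Real.log (1 - w) := by
  have h := Real.hasSum_pow_div_log_of_abs_lt_one (abs_lt.mpr ⟨by linarith, h1⟩)
  -- The first two terms of the power series of `-log (1 - w)`, whose terms are nonnegative.
  have := h.summable.sum_le_tsum (Finset.range 2) fun i _ => by positivity
  rw [h.tsum_eq] at this
  simp [Finset.sum_range_succ] at this
  norm_num at this
  exact this

/-- With `w = 1 - x/t`, the first summand of the divergence is `-t log (1 - w)`; its linear term
cancels against the bound for the second summand, and the quadratic term remains. -/
theorem sq_div_le_bernoulliKL {t x : ℝ} (hx : 0 < x) (hxt : x < t) (ht : t < 1) :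
    (t - x) ^ 2 / (2 * t) ≤ bernoulliKL t x := by
  have ht0 : 0 < t := hx.trans hxt
  refine le_trans ?_ (le_bernoulliKL hxt ht)
  have h := add_sq_div_two_le_neg_log (w := (t - x) / t) (div_nonneg (by linarith) ht0.le)
    ((div_lt_one ht0).mpr (by linarith))
  have h2 : 1 - (t - x) / t = (t / x)⁻¹ := by field_simp; ring
  rw [h2, Real.log_inv, neg_neg] at h
  have h3 := mul_le_mul_of_nonneg_left h ht0.le
  have h4 : t * ((t - x) / t + ((t - x) / t) ^ 2 / 2) = (t - x) + (t - x) ^ 2 / (2 * t) := by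
    field_simp
  linarith

/-- Applying `log v ≤ v - 1` to both summands bounds the relative entropy by the chi-square
divergence. -/
theorem bernoulliKL_le_sq_div {t x : ℝ} (hx : 0 < x) (hxt : x < t) (ht : t < 1) :
    bernoulliKL t x ≤ (t - x) ^ 2 / (x * (1 - x)) := by
  have hx1 : 0 < 1 - x := by linarith
  have ht1 : 0 < 1 - t := by linarith
  have h1 := Real.log_le_sub_one_of_pos (div_pos (hx.trans hxt) hx)
  have h2 := Real.log_le_sub_one_of_pos (div_pos ht1 hx1)
  have h3 : (t - x) ^ 2 / (x * (1 - x)) =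
      t * (t / x - 1) + (1 - t) * ((1 - t) / (1 - x) - 1) := by field_simp; ring
  rw [h3, bernoulliKL]
  have := hx.trans hxt
  gcongr

theorem bernoulliKL_self {t : ℝ} (h0 : 0 < t) (h1 : t < 1) : bernoulliKL t t = 0 := by
  simp [bernoulliKL, div_self h0.ne', div_self (show 1 - t ≠ 0 by linarith)]

theorem convexOn_bernoulliKL {t : ℝ} (h0 : 0 < t) (h1 : t < 1) :
    ConvexOn ℝ (Set.Ioo 0 1) (bernoulliKL t) := by
  have hl : ConcaveOn ℝ (Set.Ioo 0 1) Real.log :=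
    strictConcaveOn_log_Ioi.concaveOn.subset (fun x hx => hx.1) (convex_Ioo 0 1)
  refine ⟨convex_Ioo 0 1, fun x hx y hy a b ha hb hab => ?_⟩
  have e : ∀ z ∈ Set.Ioo (0:ℝ) 1, bernoulliKL t z = (t * Real.log t + (1 - t) * Real.log (1 - t))
      - t * Real.log z - (1 - t) * Real.log (1 - z) := by
    intro z hz
    rw [bernoulliKL, Real.log_div h0.ne' hz.1.ne',
      Real.log_div (by linarith) (by linarith [hz.2])]
    ring
  rw [e _ hx, e _ hy, e _ ((convex_Ioo 0 1) hx hy ha hb hab)]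
  have c1 := hl.2 hx hy ha hb hab
  have c2 := hl.2 (x := 1 - x) ⟨by linarith [hx.2], by linarith [hx.1]⟩ (y := 1 - y)
    ⟨by linarith [hy.2], by linarith [hy.1]⟩ ha hb hab
  simp only [smul_eq_mul] at *
  have e2 : a * (1 - x) + b * (1 - y) = 1 - (a * x + b * y) := by
    linear_combination hab
  rw [e2] at c2
  have d1 := mul_le_mul_of_nonneg_left c1 h0.le
  have d2 := mul_le_mul_of_nonneg_left c2 (show 0 ≤ 1 - t by linarith)
  obtain rfl : b = 1 - a := by linarith
  linarith

/-- By convexity, the divergence decreases at least linearly on the way from `x` to `t`. -/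
theorem bernoulliKL_le_mul {t x s : ℝ} (hx : 0 < x) (hxt : x < t) (ht : t < 1) (hxs : x ≤ s)
    (hst : s ≤ t) : bernoulliKL t s ≤ (t - s) / (t - x) * bernoulliKL t x := by
  have h0 := hx.trans hxt
  have hd : 0 < t - x := by linarith
  have h := (convexOn_bernoulliKL h0 ht).2 (show x ∈ Set.Ioo 0 1 from ⟨hx, hxt.trans ht⟩)
    (show t ∈ Set.Ioo 0 1 from ⟨h0, ht⟩)
    (show 0 ≤ (t - s) / (t - x) from div_nonneg (by linarith) hd.le)
    (show 0 ≤ (s - x) / (t - x) from div_nonneg (by linarith) hd.le) (by field_simp; ring)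
  simp only [smul_eq_mul, bernoulliKL_self h0 ht, mul_zero, add_zero] at h
  have e : (t - s) / (t - x) * x + (s - x) / (t - x) * t = s := by field_simp; ring
  rwa [e] at h

theorem bernoulliKL_pos {t x : ℝ} (hx : 0 < x) (hxt : x < t) (ht : t < 1) :
    0 < bernoulliKL t x := by
  refine lt_of_lt_of_le ?_ (sq_div_le_bernoulliKL hx hxt ht)
  have : 0 < t - x := by linarith
  have := hx.trans hxt
  positivity

theorem bernoulliKL_lt_of_lt {t x s : ℝ} (hx : 0 < x) (hxs : x < s) (hst : s < t) (ht : t < 1) :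
    bernoulliKL t s < bernoulliKL t x := by
  have hxt := hxs.trans hst
  have hp := bernoulliKL_pos hx hxt ht
  have h := bernoulliKL_le_mul hx hxt ht hxs.le hst.le
  have : (t - s) / (t - x) < 1 := (div_lt_one (by linarith)).mpr (by linarith)
  nlinarith

theorem bernoulliKL_le_of_le {t x s : ℝ} (hx : 0 < x) (hxs : x ≤ s) (hst : s < t) (ht : t < 1) :
    bernoulliKL t s ≤ bernoulliKL t x := by
  rcases hxs.eq_or_lt with rfl | h
  · exact le_rfl
  · exact (bernoulliKL_lt_of_lt hx h hst ht).le

/-- Every positive value of the divergence is attained below `t`. -/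
theorem exists_bernoulliKL_eq {t b : ℝ} (h0 : 0 < t) (h1 : t < 1) (hb : 0 < b) :
    ∃ x, 0 < x ∧ x < t ∧ bernoulliKL t x = b := by
  -- Chosen so that `t * log (t / x₀) = b + t`; `le_bernoulliKL` then puts the divergence at `x₀`
  -- above `b`, and continuity does the rest.
  set x₀ := t * Real.exp (-(b + t) / t)
  have hx0 : 0 < x₀ := by positivity
  have hx0t : x₀ < t := by
    have : Real.exp (-(b + t) / t) < 1 := by
      rw [Real.exp_lt_one_iff]
      exact div_neg_of_neg_of_pos (by linarith) h0
    nlinarith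
  have hlow : b ≤ bernoulliKL t x₀ := by
    refine le_trans ?_ (le_bernoulliKL hx0t h1)
    have : Real.log (t / x₀) = (b + t) / t := by
      rw [show t / x₀ = (Real.exp (-(b + t) / t))⁻¹ by simp only [x₀]; field_simp,
        Real.log_inv, Real.log_exp]
      ring
    rw [this, mul_div_cancel₀ _ h0.ne']
    linarith
  have hc : ContinuousOn (bernoulliKL t) (Set.Icc x₀ t) := by
    have hne : ∀ x ∈ Set.Icc x₀ t, x ≠ 0 := fun x hx => (hx0.trans_le hx.1).ne'
    have hne1 : ∀ x ∈ Set.Icc x₀ t, 1 - x ≠ 0 := fun x hx => by linarith [hx.2]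
    unfold bernoulliKL
    refine ContinuousOn.add (continuousOn_const.mul (ContinuousOn.log ?_ ?_))
      (continuousOn_const.mul (ContinuousOn.log ?_ ?_))
    · exact continuousOn_const.div continuousOn_id hne
    · exact fun x hx => div_ne_zero h0.ne' (hne x hx)
    · exact continuousOn_const.div (continuousOn_const.sub continuousOn_id) hne1
    · exact fun x hx => div_ne_zero (by linarith) (hne1 x hx)
  obtain ⟨x, hx, hxb⟩ := intermediate_value_Icc' hx0t.le hc
    ⟨(bernoulliKL_self h0 h1).trans_le hb.le, hlow⟩
  refine ⟨x, hx0.trans_le hx.1, lt_of_le_of_ne hx.2 ?_, hxb⟩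
  rintro rfl
  rw [bernoulliKL_self h0 h1] at hxb
  exact hb.ne hxb

/-! ### A maximal inequality by change of measure -/

/-- An event that depends only on the cells is a finite disjoint union of boxes. -/
theorem pi_measure_cells {Ω C : Type*} [MeasurableSpace Ω] [Fintype C] {n : ℕ} (μ : Measure Ω)
    [SigmaFinite μ] {v : Ω → C} (hv : ∀ c, MeasurableSet (v ⁻¹' {c})) (B : Finset (Fin n → C)) :
    Measure.pi (fun _ : Fin n => μ) {ω | (fun j => v (ω j)) ∈ B} =
      ∑ b ∈ B, ∏ j, μ (v ⁻¹' {b j}) := by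
  have h : {ω : Fin n → Ω | (fun j => v (ω j)) ∈ B} =
      ⋃ b ∈ B, Set.univ.pi fun j => v ⁻¹' {b j} := by
    ext ω
    simp only [Set.mem_ofPred_eq, Set.mem_iUnion, Set.mem_pi, Set.mem_univ, true_implies,
      Set.mem_preimage, Set.mem_singleton_iff, exists_prop]
    constructor
    · exact fun h => ⟨_, h, fun _ => rfl⟩
    · rintro ⟨b, hb, hω⟩
      rwa [show (fun j => v (ω j)) = b from funext hω]
  rw [h, measure_biUnion_finset]
  · exact Finset.sum_congr rfl fun b _ => Measure.pi_pi _ _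
  · intro b _ b' _ hne
    refine Set.disjoint_left.mpr fun ω hω hω' => hne (funext fun j => ?_)
    exact (hω j (Set.mem_univ j)).symm.trans (hω' j (Set.mem_univ j))
  · exact fun b _ => MeasurableSet.univ_pi fun j => hv _

/-- Change of measure on an event determined by the cells of the observations, on which the
likelihood ratio is at least `K`. -/
theorem mul_pi_measure_cells_le {Ω C : Type*} [MeasurableSpace Ω] [Fintype C] {n : ℕ}
    (μ ν : Measure Ω) [SigmaFinite μ] [SigmaFinite ν] {v : Ω → C}
    (hv : ∀ c, MeasurableSet (v ⁻¹' {c})) {w : C → ENNReal}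
    (hw : ∀ c, w c * μ (v ⁻¹' {c}) = ν (v ⁻¹' {c})) (B : Finset (Fin n → C)) {K : ENNReal}
    (hB : ∀ b ∈ B, K ≤ ∏ j, w (b j)) :
    K * Measure.pi (fun _ : Fin n => μ) {ω | (fun j => v (ω j)) ∈ B} ≤
      Measure.pi (fun _ : Fin n => ν) {ω | (fun j => v (ω j)) ∈ B} := by
  rw [pi_measure_cells μ hv, pi_measure_cells ν hv, Finset.mul_sum]
  refine Finset.sum_le_sum fun b hb => ?_
  simp_rw [← hw, Finset.prod_mul_distrib]
  gcongr
  exact hB b hb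

theorem pow_mul_pow_le_of_le {p q : ℝ} (hp : 1 ≤ p) (hq0 : 0 ≤ q) (hq1 : q ≤ 1) {m N n : ℕ}
    (hmN : m ≤ N) (hNn : N ≤ n) : p ^ m * q ^ (n - m) ≤ p ^ N * q ^ (n - N) := by
  have h1 : p ^ m ≤ p ^ N := pow_le_pow_right₀ hp hmN
  have h2 : q ^ (n - m) ≤ q ^ (n - N) := pow_le_pow_of_le_one hq0 hq1 (by omega)
  gcongr

/-- The law obtained from `μ` by multiplying the mass of `{f < M}` by `1 + a` and rescaling the
rest, where `M = 1 / (2 (1 + a))`. -/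
noncomputable def tilted {Ω : Type*} [MeasurableSpace Ω] (μ : Measure Ω) (f : Ω → ℝ) (a : ℝ) :
    Measure Ω :=
  -- When `f` is uniform, `{f < M}` receives mass `(1 + a) M = 1/2`, so its complement, of mass `1 -
  -- M`, must be rescaled to the remaining `1/2`.
  ENNReal.ofReal (1 + a) • μ.restrict {u | f u < 1 / (2 * (1 + a))} +
    ENNReal.ofReal (1 / 2 / (1 - 1 / (2 * (1 + a)))) • μ.restrict {u | f u < 1 / (2 * (1 + a))}ᶜ

section Tilted

variable {Ω : Type*} [MeasurableSpace Ω] {μ : Measure Ω} {f : Ω → ℝ} {a : ℝ}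

theorem tilted_apply_of_subset (hf : Measurable f) {s : Set Ω}
    (hs : s ⊆ {u | f u < 1 / (2 * (1 + a))}) : tilted μ f a s = ENNReal.ofReal (1 + a) * μ s := by
  have hm : MeasurableSet {u | f u < 1 / (2 * (1 + a))} := measurableSet_lt hf measurable_const
  rw [tilted, Measure.add_apply, Measure.smul_apply, Measure.smul_apply,
    Measure.restrict_eq_self _ hs, Measure.restrict_apply' hm.compl]
  have : s ∩ {u | f u < 1 / (2 * (1 + a))}ᶜ = ∅ := by
    ext u; simpa using fun hu => hs hu
  rw [this, measure_empty, smul_zero, add_zero, smul_eq_mul]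

theorem isProbabilityMeasure_tilted [IsProbabilityMeasure μ] (hf : Measurable f) (ha : 0 ≤ a)
    (hunif : ∀ x, 0 < x → x < 1 → μ {u | f u < x} = ENNReal.ofReal x) :
    IsProbabilityMeasure (tilted μ f a) := by
  have hm : MeasurableSet {u | f u < 1 / (2 * (1 + a))} := measurableSet_lt hf measurable_const
  have hM0 : 0 < 1 / (2 * (1 + a)) := by positivity
  have hM1 : 1 / (2 * (1 + a)) < 1 := by rw [div_lt_one (by positivity)]; linarith
  refine ⟨?_⟩
  rw [tilted, Measure.add_apply, Measure.smul_apply, Measure.smul_apply,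
    Measure.restrict_apply_univ, Measure.restrict_apply_univ, prob_compl_eq_one_sub hm,
    hunif _ hM0 hM1, smul_eq_mul, smul_eq_mul, ← ENNReal.ofReal_one, ← ENNReal.ofReal_sub _ hM0.le,
    ← ENNReal.ofReal_mul (by linarith), ← ENNReal.ofReal_mul (by
      have : 0 < 1 - 1 / (2 * (1 + a)) := by linarith
      positivity),
    ← ENNReal.ofReal_add (by positivity) (by
      have : 0 < 1 - 1 / (2 * (1 + a)) := by linarith
      positivity), div_mul_cancel₀ _ (by linarith)]
  congr 1
  field_simp
  norm_num

/-- The density of the tilted law need not be constant on `{f < x}ᶜ`, but for events that do not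
subdivide this cell only the ratio of its two masses matters. This is why a single tilted law serves
every threshold `x ≤ M`. -/
theorem tilted_compl [IsProbabilityMeasure μ] (hf : Measurable f) (ha : 0 ≤ a)
    (hunif : ∀ x, 0 < x → x < 1 → μ {u | f u < x} = ENNReal.ofReal x) {x : ℝ} (hx0 : 0 < x)
    (hx : (1 + a) * x ≤ 1 / 2) :
    tilted μ f a {u | f u < x}ᶜ =
      ENNReal.ofReal ((1 - (1 + a) * x) / (1 - x)) * μ {u | f u < x}ᶜ := by
  have hm : MeasurableSet {u | f u < x} := measurableSet_lt hf measurable_const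
  have hx1 : x < 1 := by nlinarith
  have := isProbabilityMeasure_tilted hf ha hunif
  have hsub : {u | f u < x} ⊆ {u | f u < 1 / (2 * (1 + a))} := by
    intro u hu
    refine lt_of_lt_of_le (show f u < x from hu) ?_
    rw [le_div_iff₀ (by positivity)]
    linarith
  rw [prob_compl_eq_one_sub hm, prob_compl_eq_one_sub hm, tilted_apply_of_subset hf hsub,
    hunif x hx0 hx1, ← ENNReal.ofReal_one, ← ENNReal.ofReal_sub _ hx0.le,
    ← ENNReal.ofReal_mul (by linarith), ← ENNReal.ofReal_sub _ (by positivity),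
    ← ENNReal.ofReal_mul (div_nonneg (by linarith) (by linarith)), div_mul_cancel₀ _ (by linarith)]

end Tilted

open Classical in
/-- A maximal inequality for the empirical process of i.i.d. observations with uniform p-values
`f`: if at every threshold `ξ i` a count of at least `m i` forces the likelihood ratio of the
tilted law to be at least `exp c`, then the probability that the count is that large at some
threshold is at most `exp (-c)`. -/
theorem pi_exists_count_ge_le {Ω ι : Type*} [MeasurableSpace Ω] [Fintype ι] [LinearOrder ι]
    (μ : Measure Ω) [IsProbabilityMeasure μ] {f : Ω → ℝ} (hf : Measurable f)
    (hunif : ∀ x, 0 < x → x < 1 → μ {u | f u < x} = ENNReal.ofReal x)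
    {n : ℕ} (I : Finset ι) {ξ : ι → ℝ} {m : ι → ℕ} {a c : ℝ} (ha : 0 ≤ a)
    (hξ0 : ∀ i ∈ I, 0 < ξ i) (hξ : ∀ i ∈ I, (1 + a) * ξ i ≤ 1 / 2)
    (hlik : ∀ i ∈ I, Real.exp c ≤
      (1 + a) ^ m i * ((1 - (1 + a) * ξ i) / (1 - ξ i)) ^ (n - m i)) :
    Measure.pi (fun _ : Fin n => μ)
      {ω | ∃ i ∈ I, m i ≤ (Finset.univ.filter fun j => f (ω j) < ξ i).card} ≤
      ENNReal.ofReal (Real.exp (-c)) := by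
  have hprob := isProbabilityMeasure_tilted hf ha hunif
  -- Ordering by threshold, with ties broken by the index, makes "the first threshold exceeded"
  -- unique.
  let key : ι → ℝ ×ₗ ι := fun i => toLex (ξ i, i)
  have hkey_inj : Function.Injective key := fun i j h => by
    simpa [key] using (congrArg Prod.snd (toLex.injective h))
  have hkey_le : ∀ {l i}, key l ≤ key i → ξ l ≤ ξ i := fun {l i} h => by
    rcases (Prod.Lex.toLex_le_toLex.mp h) with h | h
    · exact h.le
    · exact h.1.le
  -- The cell of `u` records which thresholds up to `ξ i` lie above `f u`. It decides all counts up
  -- to the key of `i`, and it leaves `{f ≥ ξ i}` undivided, as the empty cell.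
  let v : ι → Ω → Finset ι := fun i u => I.filter fun l => ξ l ≤ ξ i ∧ f u < ξ l
  -- `i` is the first index, in the order of `key`, whose count is large.
  let B : ι → Finset (Fin n → Finset ι) := fun i => Finset.univ.filter fun b =>
    m i ≤ (Finset.univ.filter fun j => i ∈ b j).card ∧
      ∀ l ∈ I, key l < key i → (Finset.univ.filter fun j => l ∈ b j).card < m l
  let A : ι → Set (Fin n → Ω) := fun i => {ω | (fun j => v i (ω j)) ∈ B i}
  have hA : ∀ i ∈ I, ∀ ω, ω ∈ A i ↔ m i ≤ (Finset.univ.filter fun j => f (ω j) < ξ i).card ∧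
      ∀ l ∈ I, key l < key i → (Finset.univ.filter fun j => f (ω j) < ξ l).card < m l := by
    intro i hi ω
    have e : ∀ l ∈ I, key l ≤ key i → (Finset.univ.filter fun j => l ∈ v i (ω j)) =
        Finset.univ.filter fun j => f (ω j) < ξ l := by
      intro l hl hle
      ext j
      simp [v, hl, hkey_le hle]
    simp only [A, B, Set.mem_ofPred_eq, Finset.mem_filter, Finset.mem_univ, true_and]
    rw [e i hi le_rfl]
    refine and_congr_right fun _ => forall₃_congr fun l hl hlt => ?_
    rw [e l hl hlt.le]
  have hvm : ∀ i c, MeasurableSet (v i ⁻¹' {c}) := by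
    intro i c
    have : v i ⁻¹' {c} = ⋂ l, {u | (l ∈ I ∧ ξ l ≤ ξ i ∧ f u < ξ l) ↔ l ∈ c} := by
      ext u
      simp [v, Finset.ext_iff]
    rw [this]
    refine MeasurableSet.iInter fun l => ?_
    have hm : MeasurableSet {u | f u < ξ l} := measurableSet_lt hf measurable_const
    exact ((MeasurableSet.const _).inter ((MeasurableSet.const _).inter hm)).iff (.const _)
  have hAm : ∀ i, MeasurableSet (A i) := by
    intro i
    have : A i = ⋃ b ∈ B i, Set.univ.pi fun j => v i ⁻¹' {b j} := by
      ext ω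
      simp only [A, Set.mem_ofPred_eq, Set.mem_iUnion, Set.mem_pi, Set.mem_univ, true_implies,
        Set.mem_preimage, Set.mem_singleton_iff, exists_prop]
      exact ⟨fun h => ⟨_, h, fun _ => rfl⟩, fun ⟨b, hb, h⟩ => (funext h : _ = b) ▸ hb⟩
    rw [this]
    exact Finset.measurableSet_biUnion _ fun b _ => MeasurableSet.univ_pi fun j => hvm _ _
  have hbound : ∀ i ∈ I, ENNReal.ofReal (Real.exp c) * Measure.pi (fun _ : Fin n => μ) (A i) ≤
      Measure.pi (fun _ : Fin n => tilted μ f a) (A i) := by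
    intro i hi
    have hx1 : ξ i < 1 := by nlinarith [hξ0 i hi, hξ i hi]
    have hr0 : 0 ≤ (1 - (1 + a) * ξ i) / (1 - ξ i) :=
      div_nonneg (by linarith [hξ i hi]) (by linarith)
    have hr1 : (1 - (1 + a) * ξ i) / (1 - ξ i) ≤ 1 := by
      rw [div_le_one (by linarith)]
      nlinarith [hξ0 i hi]
    -- A cell containing `i` lies in `{f < ξ i}`, where the density is `1 + a`; every other cell is
    -- either void or all of `{f ≥ ξ i}`.
    refine mul_pi_measure_cells_le (w := fun c => if i ∈ c then ENNReal.ofReal (1 + a) else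
      ENNReal.ofReal ((1 - (1 + a) * ξ i) / (1 - ξ i))) μ (tilted μ f a) (hvm i) ?_ (B i) ?_
    · intro c
      split_ifs with hic
      · refine (tilted_apply_of_subset hf fun u hu => ?_).symm
        have h1 : i ∈ v i u := by
          rw [show v i u = c from hu]; exact hic
        have h2 : f u < ξ i := by simpa [v, hi] using h1
        refine lt_of_lt_of_le h2 ?_
        rw [le_div_iff₀ (by positivity)]
        linarith [hξ i hi]
      · have hsub : v i ⁻¹' {c} ⊆ {u | f u < ξ i}ᶜ := by
          intro u hu hu'
          refine hic ?_
          rw [← show v i u = c from hu]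
          simpa [v, hi] using hu'
        have hemp : ∀ u ∈ {u | f u < ξ i}ᶜ, v i u = ∅ := by
          intro u hu
          have hu' : ξ i ≤ f u := by simpa using hu
          refine Finset.filter_eq_empty_iff.mpr fun l _ h => ?_
          linarith [h.1, h.2]
        by_cases hc : c = ∅
        · have : v i ⁻¹' {c} = {u | f u < ξ i}ᶜ :=
            hsub.antisymm fun u hu => by
              rw [Set.mem_preimage, hemp u hu, hc]; exact Set.mem_singleton _
          rw [this, tilted_compl hf ha hunif (hξ0 i hi) (hξ i hi)]
        · have : v i ⁻¹' {c} = ∅ := by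
            refine Set.eq_empty_of_forall_notMem fun u hu => hc ?_
            rw [← hemp u (hsub hu)]
            exact (show v i u = c from hu).symm
          simp [this]
    · intro b hb
      have hb1 : m i ≤ (Finset.univ.filter fun j => i ∈ b j).card :=
        (Finset.mem_filter.mp hb).2.1
      have hb2 : (Finset.univ.filter fun j => i ∈ b j).card ≤ n := by
        simpa using Finset.card_filter_le (Finset.univ : Finset (Fin n)) fun j => i ∈ b j
      have hb3 : (Finset.univ.filter fun j => i ∉ b j).card =
          n - (Finset.univ.filter fun j => i ∈ b j).card := by
        have := Finset.card_filter_add_card_filter_not (s := (Finset.univ : Finset (Fin n)))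
          (fun j => i ∈ b j)
        simp only [Finset.card_univ, Fintype.card_fin] at this
        omega
      rw [Finset.prod_ite, Finset.prod_const, Finset.prod_const, hb3,
        ← ENNReal.ofReal_pow (by linarith), ← ENNReal.ofReal_pow hr0,
        ← ENNReal.ofReal_mul (by positivity)]
      exact ENNReal.ofReal_le_ofReal
        ((hlik i hi).trans (pow_mul_pow_le_of_le (by linarith) hr0 hr1 hb1 hb2))
  have hcover : {ω : Fin n → Ω | ∃ i ∈ I, m i ≤ (Finset.univ.filter fun j => f (ω j) < ξ i).card} ⊆
      ⋃ i ∈ I, A i := by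
    rintro ω ⟨i, hi, h⟩
    obtain ⟨i₀, hi₀, hmin⟩ := Finset.exists_min_image
      (I.filter fun i => m i ≤ (Finset.univ.filter fun j => f (ω j) < ξ i).card) key
      ⟨i, Finset.mem_filter.mpr ⟨hi, h⟩⟩
    rw [Finset.mem_filter] at hi₀
    refine Set.mem_biUnion hi₀.1 ((hA i₀ hi₀.1 ω).mpr ⟨hi₀.2, fun l hl hlt => ?_⟩)
    by_contra hge
    exact absurd (hmin l (Finset.mem_filter.mpr ⟨hl, not_lt.mp hge⟩)) (not_le.mpr hlt)
  have hdisj : (I : Set ι).PairwiseDisjoint A := by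
    intro i hi j hj hne
    refine Set.disjoint_left.mpr fun ω hωi hωj => ?_
    rw [hA i hi] at hωi
    rw [hA j hj] at hωj
    rcases lt_trichotomy (key i) (key j) with h | h | h
    · exact absurd (hωj.2 i hi h) (not_lt.mpr hωi.1)
    · exact hne (hkey_inj h)
    · exact absurd (hωi.2 j hj h) (not_lt.mpr hωj.1)
  have hexp : ENNReal.ofReal (Real.exp (-c)) * ENNReal.ofReal (Real.exp c) = 1 := by
    rw [← ENNReal.ofReal_mul (Real.exp_nonneg _), ← Real.exp_add]
    simp
  -- The sum over thresholds costs nothing: the disjoint events are all measured by one and the same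
  -- probability law.
  calc _ ≤ Measure.pi (fun _ : Fin n => μ) (⋃ i ∈ I, A i) := measure_mono hcover
    _ = ENNReal.ofReal (Real.exp (-c)) * (ENNReal.ofReal (Real.exp c) *
        ∑ i ∈ I, Measure.pi (fun _ : Fin n => μ) (A i)) := by
      rw [← mul_assoc, hexp, one_mul, measure_biUnion_finset hdisj fun i _ => hAm i]
    _ ≤ ENNReal.ofReal (Real.exp (-c)) *
        ∑ i ∈ I, Measure.pi (fun _ : Fin n => tilted μ f a) (A i) := by
      rw [Finset.mul_sum (s := I)]
      gcongr with i hi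
      exact hbound i hi
    _ = ENNReal.ofReal (Real.exp (-c)) *
        Measure.pi (fun _ : Fin n => tilted μ f a) (⋃ i ∈ I, A i) := by
      rw [measure_biUnion_finset hdisj fun i _ => hAm i]
    _ ≤ ENNReal.ofReal (Real.exp (-c)) := mul_le_of_le_one_right' prob_le_one

/-! ### Order statistics and the rejection event -/

theorem orderStat_mono {n : ℕ} (p : Fin n → ℝ) : Monotone (orderStat p) :=
  Tuple.monotone_sort p

theorem succ_le_card_of_orderStat_lt {n : ℕ} {p : Fin n → ℝ} {i : Fin n} {x : ℝ}
    (h : orderStat p i < x) : (i : ℕ) + 1 ≤ (Finset.univ.filter fun j => p j < x).card := by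
  calc (i : ℕ) + 1 = ((Finset.Iic i).image (Tuple.sort p)).card := by
        rw [Finset.card_image_of_injective _ (Tuple.sort p).injective, Fin.card_Iic]
    _ ≤ _ := by
        refine Finset.card_le_card fun j hj => ?_
        obtain ⟨l, hl, rfl⟩ := Finset.mem_image.mp hj
        exact Finset.mem_filter.mpr ⟨Finset.mem_univ _,
          (orderStat_mono p (Finset.mem_Iic.mp hl)).trans_lt h⟩

theorem orderStat_le_of_succ_le_card {n : ℕ} {p : Fin n → ℝ} {i : Fin n} {x : ℝ}
    (h : (i : ℕ) + 1 ≤ (Finset.univ.filter fun j => p j ≤ x).card) : orderStat p i ≤ x := by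
  by_contra hlt
  rw [not_le] at hlt
  have : (Finset.univ.filter fun j => p j ≤ x).card ≤
      ((Finset.Iio i).image (Tuple.sort p)).card := by
    refine Finset.card_le_card fun j hj => Finset.mem_image.mpr
      ⟨(Tuple.sort p).symm j, Finset.mem_Iio.mpr ?_, by simp⟩
    by_contra hge
    have h1 := orderStat_mono p (not_lt.mp hge)
    rw [orderStat, orderStat, Equiv.apply_symm_apply] at h1
    exact absurd (hlt.trans_le h1) (not_lt.mpr (Finset.mem_filter.mp hj).2)
  rw [Finset.card_image_of_injective _ (Tuple.sort p).injective, Fin.card_Iio] at this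
  omega

theorem kPlus_eq_bernoulliKL {t x : ℝ} (hx : 0 < x) (hxt : x < t) (ht : t < 1) :
    kPlus t x = (bernoulliKL t x : ℝ) := by
  rw [kPlus, if_pos ⟨hx, hxt, ht⟩, bernoulliKL]

/-- p-values lie strictly between `0` and `1`, so the value `⊤` of `kPlus` never occurs here; as `b
≥ 0`, indices with `kPlus` equal to `0` cannot cause rejection. -/
theorem exists_of_mem_rejects {n : ℕ} (hn : 0 < n) {b : ℝ} (hb : 0 ≤ b) {X : Fin n → ℝ}
    (hX : X ∈ rejects n b) :
    ∃ i : Fin n, ((i : ℝ) + 1) ≤ (n : ℝ) / 2 ∧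
      orderStat (fun j => pValue (X j)) i < ((i : ℝ) + 1) / n ∧
      b / n < bernoulliKL (((i : ℝ) + 1) / n) (orderStat (fun j => pValue (X j)) i) := by
  by_contra! hcon
  have hn' : (0 : ℝ) < n := by exact_mod_cast hn
  have hle : (⨆ (i : Fin n) (_ : ((i : ℝ) + 1) ≤ (n : ℝ) / 2),
      kPlus (((i : ℝ) + 1) / n) (orderStat (fun j => pValue (X j)) i)) ≤ ((b / n : ℝ) : EReal) := by
    refine iSup₂_le fun i hi => ?_
    have hp : 0 < orderStat (fun j => pValue (X j)) i := pValue_pos _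
    have hp1 : orderStat (fun j => pValue (X j)) i < 1 := pValue_lt_one _
    have ht : ((i : ℝ) + 1) / n < 1 := by rw [div_lt_one hn']; linarith
    rcases lt_or_ge (orderStat (fun j => pValue (X j)) i) (((i : ℝ) + 1) / n) with h | h
    · rw [kPlus_eq_bernoulliKL hp h ht]
      exact_mod_cast hcon i hi h
    · rw [kPlus, if_neg (fun h' => absurd h'.2.1 (not_lt.mpr h)), if_pos ⟨by positivity, h, hp1.le⟩]
      exact_mod_cast div_nonneg hb hn'.le
  have h2 : bjStat X ≤ (b : EReal) := by
    calc bjStat X ≤ (n : EReal) * ((b / n : ℝ) : EReal) := by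
          unfold bjStat
          gcongr
      _ = (b : EReal) := by
          rw [← EReal.coe_natCast, ← EReal.coe_mul, mul_div_cancel₀ _ hn'.ne']
  exact absurd (show (b : EReal) < bjStat X from hX) (not_lt.mpr h2)

theorem mem_rejects_of_lt {n : ℕ} {b : ℝ} {X : Fin n → ℝ} (i : Fin n)
    (hi : ((i : ℝ) + 1) ≤ (n : ℝ) / 2)
    (hp : orderStat (fun j => pValue (X j)) i < ((i : ℝ) + 1) / n)
    (hb : b < n * bernoulliKL (((i : ℝ) + 1) / n) (orderStat (fun j => pValue (X j)) i)) :
    X ∈ rejects n b := by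
  have hn' : (0 : ℝ) < n := by
    have : (0 : ℝ) ≤ i := by positivity
    linarith
  have ht : ((i : ℝ) + 1) / n < 1 := by rw [div_lt_one hn']; linarith
  show (b : EReal) < bjStat X
  calc (b : EReal) < (n : EReal) *
        kPlus (((i : ℝ) + 1) / n) (orderStat (fun j => pValue (X j)) i) := by
        have hpos : 0 < orderStat (fun j => pValue (X j)) i := pValue_pos _
        rw [kPlus_eq_bernoulliKL hpos hp ht, ← EReal.coe_natCast, ← EReal.coe_mul]
        exact_mod_cast hb
    _ ≤ bjStat X := by
        unfold bjStat
        gcongr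
        exact le_iSup₂ (f := fun (i : Fin n) (_ : ((i : ℝ) + 1) ≤ (n : ℝ) / 2) =>
            kPlus (((i : ℝ) + 1) / n) (orderStat (fun j => pValue (X j)) i)) i hi

/-! ### The level of the test -/

/-- The left side is the log-likelihood ratio per observation, at empirical frequency `t`, of the
tilt that moves the mass below the threshold from `x` to `s`. The optimal tilt is `s = t`, and
`bernoulliKL t s` is the loss for stopping short. -/
theorem bernoulliKL_sub {t x s : ℝ} (hx : 0 < x) (hxs : x ≤ s) (hst : s ≤ t) (ht : t < 1) :
    t * Real.log (s / x) + (1 - t) * Real.log ((1 - s) / (1 - x)) =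
      bernoulliKL t x - bernoulliKL t s := by
  have hs : 0 < s := hx.trans_le hxs
  have ht0 : 0 < t := hs.trans_le hst
  rw [bernoulliKL, bernoulliKL, Real.log_div hs.ne' hx.ne', Real.log_div ht0.ne' hx.ne',
    Real.log_div ht0.ne' hs.ne', Real.log_div (by linarith) (by linarith),
    Real.log_div (by linarith) (by linarith), Real.log_div (by linarith) (by linarith)]
  ring

/-- The likelihood ratio of the tilted law in terms of the divergence, at a point `x` with
`bernoulliKL (m / n) x = b / n` and a tilt that falls short of the optimal one by a factor of at
most `1 + 1 / b`. -/
theorem exp_le_likelihood {n m : ℕ} {b t x a : ℝ} (hb : 1 ≤ b) (hn : 0 < n) (hmn : m ≤ n)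
    (htm : t = (m : ℝ) / n) (hx : 0 < x) (hxt : x < t) (ht : t ≤ 1 / 2)
    (hkl : bernoulliKL t x = b / n) (ha : 0 ≤ a) (ha1 : a ≤ t / x - 1)
    (ha2 : t / x - 1 ≤ a * (1 + 1 / b)) :
    Real.exp (b - 1) ≤ (1 + a) ^ m * ((1 - (1 + a) * x) / (1 - x)) ^ (n - m) := by
  have hn' : (0 : ℝ) < n := by exact_mod_cast hn
  set s := (1 + a) * x with hs
  have hxs : x ≤ s := by nlinarith
  have hst : s ≤ t := by
    have : (1 + a) * x ≤ t / x * x := by gcongr; linarith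
    rwa [div_mul_cancel₀ _ hx.ne'] at this
  -- The tilt covers all but a fraction `1 / b` of the way from `x` to `t`. By convexity the loss is
  -- at most `1 / b` of `b / n`, which over `n` observations costs `1` in the exponent.
  have hts : t - s ≤ 1 / b * (t - x) := by
    have h1 : t / x * x - x ≤ a * (1 + 1 / b) * x := by nlinarith
    rw [div_mul_cancel₀ _ hx.ne'] at h1
    have h2 : 1 / b * s ≥ 1 / b * x := by gcongr
    have h3 : t - s ≤ a * x * (1 / b) := by rw [hs]; linarith
    have h4 : a * x ≤ t - x := by linarith
    have h5 : a * x * (1 / b) ≤ (t - x) * (1 / b) := by gcongr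
    linarith
  have hpos : 0 < (1 - s) / (1 - x) := div_pos (by linarith) (by linarith)
  have e1 : (1 + a) ^ m = Real.exp (m * Real.log (s / x)) := by
    rw [hs, mul_div_cancel_right₀ _ hx.ne', mul_comm, Real.exp_mul, Real.exp_log (by linarith),
      Real.rpow_natCast]
  have e2 : ((1 - s) / (1 - x)) ^ (n - m) =
      Real.exp ((n - m : ℕ) * Real.log ((1 - s) / (1 - x))) := by
    rw [mul_comm, Real.exp_mul, Real.exp_log hpos, Real.rpow_natCast]
  rw [e1, e2, ← Real.exp_add, Real.exp_le_exp, Nat.cast_sub hmn]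
  have hm : (m : ℝ) = n * t := by rw [htm]; field_simp
  have e3 : (m : ℝ) * Real.log (s / x) + ((n : ℝ) - m) * Real.log ((1 - s) / (1 - x)) =
      n * (bernoulliKL t x - bernoulliKL t s) := by
    rw [← bernoulliKL_sub hx hxs hst (by linarith), hm]; ring
  rw [e3, hkl]
  have h4 : bernoulliKL t s ≤ 1 / b * (b / n) := by
    refine (bernoulliKL_le_mul hx hxt (by linarith) hxs hst).trans ?_
    rw [hkl]
    refine mul_le_mul_of_nonneg_right ?_ (by positivity)
    rw [div_le_iff₀ (by linarith)]
    exact hts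
  have h5 : (n : ℝ) * (b / n - 1 / b * (b / n)) = b - 1 := by field_simp
  nlinarith

/-- A quantitative bound on the level of the Berk–Jones test. -/
theorem nullLaw_rejects_le {n : ℕ} (hn : 2 ≤ n) {b : ℝ} (hb : 1 ≤ b) :
    nullLaw n (rejects n b) ≤ ENNReal.ofReal
      (((b + 1 + Real.log n / 2) * (b + 1) + 1) * Real.exp (1 - b)) := by
  classical
  have hn' : (0 : ℝ) < n := by positivity
  have hb0 : 0 < b := by linarith
  have hlogn : 0 ≤ Real.log n := Real.log_natCast_nonneg n
  let t : Fin n → ℝ := fun i => ((i : ℝ) + 1) / n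
  have hthr : ∀ i : Fin n, ∃ x, ((i : ℝ) + 1) ≤ (n : ℝ) / 2 →
      0 < x ∧ x < t i ∧ bernoulliKL (t i) x = b / n := by
    intro i
    by_cases hi : ((i : ℝ) + 1) ≤ (n : ℝ) / 2
    · obtain ⟨x, hx⟩ := exists_bernoulliKL_eq (t := t i) (b := b / n) (by positivity)
        (by simp only [t]; rw [div_lt_one hn']; linarith) (by positivity)
      exact ⟨x, fun _ => hx⟩
    · exact ⟨0, fun h => absurd h hi⟩
  choose ξ hξ using hthr
  -- The ratio of the geometric grid of tilts, matching the tolerance in `exp_le_likelihood`.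
  let θ : ℝ := 1 + 1 / b
  have hθ : 1 < θ := by simp only [θ]; linarith [show 0 < 1 / b by positivity]
  have hlogθ : 1 / (b + 1) ≤ Real.log θ := by
    have := Real.one_sub_inv_le_log_of_pos (show 0 < θ by linarith)
    refine le_trans (le_of_eq ?_) this
    simp only [θ]; field_simp; ring
  have hlogθ0 : 0 < Real.log θ := Real.log_pos hθ
  -- The optimal tilt at index `i`, and below it its grid class, in units of `1 / √n`, the least
  -- size that `A` can have.
  let A : Fin n → ℝ := fun i => t i / ξ i - 1
  let k : Fin n → ℕ := fun i => ⌊Real.log (A i * √n) / Real.log θ⌋₊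
  let M : ℕ := ⌊(b + 1 + Real.log n / 2) * (b + 1)⌋₊ + 1
  have hfacts : ∀ i : Fin n, ((i : ℝ) + 1) ≤ (n : ℝ) / 2 →
      t i ≤ 1 / 2 ∧ 1 ≤ A i * √n ∧ Real.log (A i * √n) ≤ b + 1 + Real.log n / 2 := by
    intro i hi
    obtain ⟨hx0, hxt, hkl⟩ := hξ i hi
    have ht : t i ≤ 1 / 2 := by simp only [t]; rw [div_le_iff₀ hn']; linarith
    have ht1 : 1 / (n : ℝ) ≤ t i := by simp only [t]; gcongr; simp
    have hA0 : 0 < A i := by simp only [A]; rw [sub_pos, one_lt_div hx0]; exact hxt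
    have hsq : √(n : ℝ) * √n = n := Real.mul_self_sqrt hn'.le
    have hsq0 : 0 < √(n : ℝ) := Real.sqrt_pos.mpr hn'
    refine ⟨ht, ?_, ?_⟩
    -- The chi-square bound gives `1 / n ≤ b / n ≤ A²`.
    · have h1 := bernoulliKL_le_sq_div hx0 hxt (by linarith)
      rw [hkl] at h1
      have h2 : (t i - ξ i) ^ 2 / (ξ i * (1 - ξ i)) ≤ A i ^ 2 := by
        have e : t i - ξ i = A i * ξ i := by simp only [A]; field_simp
        rw [e, div_le_iff₀ (by nlinarith)]
        have : ξ i ≤ 1 - ξ i := by linarith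
        have : 0 ≤ A i ^ 2 * ξ i := by positivity
        nlinarith
      have h3 : 1 ≤ A i ^ 2 * n := by
        have := h1.trans h2
        rw [div_le_iff₀ hn'] at this
        linarith
      by_contra hlt
      rw [not_le] at hlt
      have h5 : (A i * √n) * (A i * √n) < 1 := by nlinarith [mul_pos hA0 hsq0]
      nlinarith
    -- Since `t ≥ 1 / n`, divergence `b / n ≤ t b` forces `log (t / ξ) ≤ b + 1`.
    · have h1 := le_bernoulliKL hxt (by linarith : t i < 1)
      rw [hkl] at h1
      have ht0 : 0 < t i := lt_of_lt_of_le (by positivity) ht1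
      have h2 : Real.log (t i / ξ i) ≤ b + 1 := by
        have : t i * Real.log (t i / ξ i) ≤ t i * (b + 1) := by
          have : b / n ≤ t i * b := by rw [div_eq_mul_one_div, mul_comm]; gcongr
          linarith
        exact le_of_mul_le_mul_left this ht0
      rw [Real.log_mul hA0.ne' hsq0.ne', Real.log_sqrt hn'.le]
      have h3 : Real.log (A i) ≤ Real.log (t i / ξ i) :=
        Real.log_le_log hA0 (by simp only [A]; linarith)
      linarith
  let I : ℕ → Finset (Fin n) := fun l =>
    Finset.univ.filter fun i => ((i : ℝ) + 1) ≤ (n : ℝ) / 2 ∧ k i = l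
  let E : ℕ → Set (Fin n → ℝ) := fun l => {ω | ∃ i ∈ I l, (i : ℕ) + 1 ≤
    (Finset.univ.filter fun j => pValue (ω j) < ξ i).card}
  have hsub : rejects n b ⊆ ⋃ l ∈ Finset.range M, E l := by
    intro X hX
    obtain ⟨i, hi, hp, hlt⟩ := exists_of_mem_rejects (by omega) hb0.le hX
    obtain ⟨hx0, hxt, hkl⟩ := hξ i hi
    obtain ⟨ht, hA1, hA2⟩ := hfacts i hi
    have hpx : orderStat (fun j => pValue (X j)) i < ξ i := by
      by_contra hge
      have := bernoulliKL_le_of_le hx0 (not_lt.mp hge) hp (by linarith : t i < 1)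
      linarith
    refine Set.mem_biUnion (x := k i) ?_ ⟨i, by simp [I, hi], succ_le_card_of_orderStat_lt hpx⟩
    simp only [Finset.coe_range, Set.mem_Iio, M, Nat.lt_succ_iff, k]
    refine Nat.floor_le_floor ?_
    rw [div_le_iff₀ hlogθ0]
    have h1 : 1 ≤ (b + 1) * Real.log θ := by
      rw [div_le_iff₀ (by linarith)] at hlogθ
      linarith
    have h2 : 0 ≤ b + 1 + Real.log n / 2 := by positivity
    nlinarith
  have hE : ∀ l, nullLaw n (E l) ≤ ENNReal.ofReal (Real.exp (-(b - 1))) := by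
    intro l
    have ha0 : 0 ≤ θ ^ l / √n := by positivity
    have hcomp : ∀ i ∈ I l, θ ^ l / √n ≤ A i ∧ A i ≤ θ ^ l / √n * θ := by
      intro i hi
      obtain ⟨hi, hk⟩ := (Finset.mem_filter.mp hi).2
      obtain ⟨ht, hA1, hA2⟩ := hfacts i hi
      have hsq0 : 0 < √(n : ℝ) := Real.sqrt_pos.mpr hn'
      have hq : 0 ≤ Real.log (A i * √n) / Real.log θ := div_nonneg (Real.log_nonneg hA1) hlogθ0.le
      have h1 : (l : ℝ) ≤ Real.log (A i * √n) / Real.log θ := by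
        rw [← hk]; exact Nat.floor_le hq
      have h2 : Real.log (A i * √n) / Real.log θ < l + 1 := by
        rw [← hk]; exact Nat.lt_floor_add_one _
      rw [le_div_iff₀ hlogθ0, ← Real.log_pow,
        Real.log_le_log_iff (by positivity) (by linarith)] at h1
      rw [div_lt_iff₀ hlogθ0] at h2
      have h2' : Real.log (A i * √n) < Real.log (θ ^ (l + 1)) := by
        rw [Real.log_pow]; exact_mod_cast h2
      rw [Real.log_lt_log_iff (by linarith) (by positivity)] at h2'
      constructor
      · rw [div_le_iff₀ hsq0]; exact h1
      · rw [div_mul_eq_mul_div, le_div_iff₀ hsq0, ← pow_succ]; exact h2'.le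
    refine pi_exists_count_ge_le (gaussianReal 0 1) measurable_pValue
      (fun x => gaussianReal_pValue_lt) (I l) (m := fun i : Fin n => (i : ℕ) + 1) ha0 ?_ ?_ ?_
    · exact fun i hi => (hξ i (Finset.mem_filter.mp hi).2.1).1
    · intro i hi
      obtain ⟨hx0, hxt, -⟩ := hξ i (Finset.mem_filter.mp hi).2.1
      have h1 := (hcomp i hi).1
      have h2 := (hfacts i (Finset.mem_filter.mp hi).2.1).1
      have h3 : (1 + θ ^ l / √n) * ξ i ≤ t i / ξ i * ξ i := by
        gcongr
        simp only [A] at h1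
        linarith
      rw [div_mul_cancel₀ _ hx0.ne'] at h3
      linarith
    · intro i hi
      obtain ⟨hx0, hxt, hkl⟩ := hξ i (Finset.mem_filter.mp hi).2.1
      exact exp_le_likelihood hb (by omega) i.isLt (by simp [t]) hx0 hxt
        (hfacts i (Finset.mem_filter.mp hi).2.1).1 hkl ha0 (hcomp i hi).1 (hcomp i hi).2
  calc nullLaw n (rejects n b) ≤ ∑ l ∈ Finset.range M, nullLaw n (E l) :=
        (measure_mono hsub).trans (measure_biUnion_finset_le _ _)
    _ ≤ ∑ l ∈ Finset.range M, ENNReal.ofReal (Real.exp (-(b - 1))) :=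
        Finset.sum_le_sum fun l _ => hE l
    _ = ENNReal.ofReal (M * Real.exp (1 - b)) := by
        rw [Finset.sum_const, Finset.card_range, nsmul_eq_mul, ENNReal.ofReal_mul (by positivity),
          ENNReal.ofReal_natCast, neg_sub]
    _ ≤ _ := by
        refine ENNReal.ofReal_le_ofReal ?_
        gcongr
        simp only [M]
        push_cast
        gcongr
        exact Nat.floor_le (by positivity)

/-! ### Existence of slowly vanishing levels -/

theorem rejects_eq_empty {n : ℕ} (hn : n < 2) {b : ℝ} (hb : 0 ≤ b) : rejects n b = ∅ := by
  refine Set.eq_empty_of_forall_notMem fun X hX => ?_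
  obtain rfl | hn0 := Nat.eq_zero_or_pos n
  · have h : (b : EReal) < bjStat X := hX
    rw [bjStat, Nat.cast_zero, zero_mul] at h
    exact absurd (EReal.coe_lt_coe_iff.mp h) (not_lt.mpr hb)
  · obtain ⟨i, hi, -⟩ := exists_of_mem_rejects hn0 hb hX
    have h1 : (n : ℝ) < 2 := by exact_mod_cast hn
    have : (0 : ℝ) ≤ i := by positivity
    linarith

/-- The bound on the level provided by `nullLaw_rejects_le`. -/
noncomputable def levelBound (n : ℕ) (b : ℝ) : ℝ :=
  ((b + 1 + Real.log n / 2) * (b + 1) + 1) * Real.exp (1 - b)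

theorem levelBound_nonneg (n : ℕ) {b : ℝ} (hb : 1 ≤ b) : 0 ≤ levelBound n b := by
  have := Real.log_natCast_nonneg n
  unfold levelBound
  positivity

theorem nullLaw_real_rejects_le (n : ℕ) {b : ℝ} (hb : 1 ≤ b) :
    (nullLaw n).real (rejects n b) ≤ levelBound n b := by
  rcases lt_or_ge n 2 with hn | hn
  · rw [rejects_eq_empty hn (by linarith)]
    simpa using levelBound_nonneg n hb
  · exact ENNReal.toReal_le_of_le_ofReal (levelBound_nonneg n hb) (nullLaw_rejects_le hn hb)

theorem tendsto_add_one_mul_exp :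
    Tendsto (fun b : ℝ => (b + 1) * Real.exp (1 - b)) atTop (𝓝 0) := by
  have h1 := Real.tendsto_pow_mul_exp_neg_atTop_nhds_zero 1
  have h0 := Real.tendsto_pow_mul_exp_neg_atTop_nhds_zero 0
  have := (h1.add h0).const_mul (Real.exp 1)
  simp only [add_zero, mul_zero] at this
  refine this.congr fun b => ?_
  rw [sub_eq_add_neg, Real.exp_add]
  ring

theorem tendsto_add_one_sq_mul_exp :
    Tendsto (fun b : ℝ => ((b + 1) ^ 2 + 1) * Real.exp (1 - b)) atTop (𝓝 0) := by
  have h2 := Real.tendsto_pow_mul_exp_neg_atTop_nhds_zero 2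
  have h1 := Real.tendsto_pow_mul_exp_neg_atTop_nhds_zero 1
  have h0 := Real.tendsto_pow_mul_exp_neg_atTop_nhds_zero 0
  have := ((h2.add (h1.const_mul 2)).add (h0.const_mul 2)).const_mul (Real.exp 1)
  simp only [add_zero, mul_zero] at this
  refine this.congr fun b => ?_
  rw [sub_eq_add_neg, Real.exp_add]
  ring

theorem tendsto_levelBound (n : ℕ) : Tendsto (levelBound n) atTop (𝓝 0) := by
  have := tendsto_add_one_sq_mul_exp.add (tendsto_add_one_mul_exp.const_mul (Real.log n / 2))
  simp only [add_zero, mul_zero] at this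
  refine this.congr fun b => ?_
  unfold levelBound
  ring

theorem tendsto_log_log : Tendsto (fun n : ℕ => Real.log (Real.log n)) atTop atTop :=
  Real.tendsto_log_atTop.comp (Real.tendsto_log_atTop.comp tendsto_natCast_atTop_atTop)

/-- With `L = log log n`, the factor `exp (-L)` cancels the `log n` in the bound, and `exp (-√L)`
beats the remaining polynomial in `√L`. -/
theorem tendsto_levelBound_log_log :
    Tendsto (fun n : ℕ => levelBound n (Real.log (Real.log n) + √(Real.log (Real.log n))))
      atTop (𝓝 0) := by
  have hs := Real.tendsto_sqrt_atTop.comp tendsto_log_log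
  have hb := tendsto_log_log.atTop_add_atTop hs
  have h2 := Real.tendsto_pow_mul_exp_neg_atTop_nhds_zero 2
  have h1 := Real.tendsto_pow_mul_exp_neg_atTop_nhds_zero 1
  have h0 := Real.tendsto_pow_mul_exp_neg_atTop_nhds_zero 0
  have h3 := ((((h2.add h1).add h0).const_mul (Real.exp 1 / 2)).comp hs)
  have := (tendsto_add_one_sq_mul_exp.comp hb).add h3
  simp only [add_zero, mul_zero] at this
  refine this.congr' ?_
  filter_upwards [tendsto_log_log.eventually_ge_atTop 0,
    (Real.tendsto_log_atTop.comp tendsto_natCast_atTop_atTop).eventually_gt_atTop 0] with n hL hl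
  simp only [Function.comp_apply] at hl ⊢
  set L := Real.log (Real.log n) with hLdef
  have hexp : Real.log n = Real.exp L := (Real.exp_log hl).symm
  have hsq : √L ^ 2 = L := Real.sq_sqrt hL
  have e1 : Real.exp (1 - (L + √L)) = Real.exp 1 * Real.exp (-√L) * Real.exp (-L) := by
    rw [← Real.exp_add, ← Real.exp_add]; ring_nf
  have e2 : Real.exp L * Real.exp (-L) = 1 := by rw [← Real.exp_add]; simp
  rw [levelBound, hexp, e1, hsq]
  linear_combination (-(L + √L + 1) / 2 * Real.exp 1 * Real.exp (-√L)) * e2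

/-- Levels tending to `0` slowly enough exist. -/
theorem exists_slowlyEnough : ∃ α b : ℕ → ℝ, SlowlyEnough α b := by
  classical
  have hB : ∀ n : ℕ, ∃ b, 1 ≤ b ∧ levelBound n b ≤ 1 / 2 := fun n =>
    ((eventually_ge_atTop 1).and
      ((tendsto_levelBound n).eventually_le_const (by norm_num))).exists
  choose B hB1 hB2 using hB
  let c : ℕ → ℝ := fun n => Real.log (Real.log n) + √(Real.log (Real.log n))
  -- The fallback `B n` is needed only for finitely many `n`; it keeps every level below `1`.
  let b : ℕ → ℝ := fun n => if 1 ≤ c n ∧ levelBound n (c n) ≤ 1 / 2 then c n else B n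
  have hb1 : ∀ n, 1 ≤ b n := fun n => by
    simp only [b]; split_ifs with h
    exacts [h.1, hB1 n]
  have hb2 : ∀ n, levelBound n (b n) ≤ 1 / 2 := fun n => by
    simp only [b]; split_ifs with h
    exacts [h.2, hB2 n]
  have hbc : b =ᶠ[atTop] c := by
    filter_upwards [(tendsto_log_log.atTop_add_atTop
      (Real.tendsto_sqrt_atTop.comp tendsto_log_log)).eventually_ge_atTop 1,
      tendsto_levelBound_log_log.eventually_le_const (show (0 : ℝ) < 1 / 2 by norm_num)]
      with n h1 h2
    exact if_pos ⟨h1, h2⟩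
  have hP : Tendsto (fun n => (nullLaw n).real (rejects n (b n))) atTop (𝓝 0) := by
    refine squeeze_zero' (.of_forall fun n => measureReal_nonneg) ?_ tendsto_levelBound_log_log
    filter_upwards [hbc] with n hn
    exact (nullLaw_real_rejects_le n (hb1 n)).trans_eq (by rw [hn])
  -- The term `1 / (n + 2)` keeps the levels strictly positive.
  refine ⟨fun n => max ((nullLaw n).real (rejects n (b n))) (1 / ((n : ℝ) + 2)), b, ?_, ?_, ?_, ?_⟩
  · intro n
    refine ⟨lt_max_of_lt_right (by positivity), max_lt ?_ ?_⟩
    · exact ((nullLaw_real_rejects_le n (hb1 n)).trans (hb2 n)).trans_lt (by norm_num)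
    · rw [div_lt_one (by positivity)]
      have : (0 : ℝ) ≤ n := by positivity
      linarith
  · have h2 : Tendsto (fun n : ℕ => 1 / ((n : ℝ) + 2)) atTop (𝓝 0) :=
      tendsto_const_nhds.div_atTop
        (tendsto_atTop_add_const_right _ _ tendsto_natCast_atTop_atTop)
    simpa using hP.max h2
  · exact fun n => le_max_left _ _
  · refine Asymptotics.IsEquivalent.congr_left ?_ hbc.symm
    refine Asymptotics.IsEquivalent.refl.add_isLittleO ?_
    have h : (fun x : ℝ => √x) =o[atTop] fun x : ℝ => x := by
      refine Asymptotics.isLittleO_of_tendsto' ?_ ?_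
      · filter_upwards [eventually_gt_atTop 0] with x hx h0
        exact absurd h0 hx.ne'
      · simp_rw [Real.sqrt_div_self', one_div]
        exact Real.tendsto_sqrt_atTop.inv_tendsto_atTop
    exact h.comp_tendsto tendsto_log_log

/-! ### Powerlessness below the boundary: truncated second moments -/

/-- The likelihood ratio of the mixture with respect to the standard normal law. -/
noncomputable def mixtureDensity (ε μ x : ℝ) : ℝ := 1 - ε + ε * Real.exp (μ * x - μ ^ 2 / 2)

theorem measurable_mixtureDensity (ε μ : ℝ) : Measurable (mixtureDensity ε μ) := by
  unfold mixtureDensity; fun_prop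

theorem isProbabilityMeasure_mixture {ε : ℝ} (h0 : 0 ≤ ε) (h1 : ε ≤ 1) (μ : ℝ) :
    IsProbabilityMeasure (mixture ε μ) := by
  refine ⟨?_⟩
  rw [mixture, Measure.add_apply, Measure.smul_apply, Measure.smul_apply, measure_univ,
    measure_univ, smul_eq_mul, smul_eq_mul, mul_one, mul_one,
    ← ENNReal.ofReal_add (by linarith) h0, sub_add_cancel, ENNReal.ofReal_one]

theorem mixture_eq_withDensity {ε : ℝ} (h0 : 0 ≤ ε) (h1 : ε ≤ 1) (μ : ℝ) :
    mixture ε μ = (gaussianReal 0 1).withDensity fun x => ENNReal.ofReal (mixtureDensity ε μ x) := by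
  have h : (fun x => ENNReal.ofReal (mixtureDensity ε μ x)) =
      (fun _ => ENNReal.ofReal (1 - ε)) +
        ENNReal.ofReal ε • fun x => ENNReal.ofReal (Real.exp (μ * x - μ ^ 2 / 2)) := by
    ext x
    rw [mixtureDensity, ENNReal.ofReal_add (by linarith) (by positivity), ENNReal.ofReal_mul h0]
    rfl
  rw [h, withDensity_add_left measurable_const, withDensity_const,
    withDensity_smul _ (by fun_prop), ← gaussianReal_eq_withDensity, mixture]

theorem mixture_real_Ioi {ε : ℝ} (h0 : 0 ≤ ε) (h1 : ε ≤ 1) (μ y : ℝ) :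
    (mixture ε μ).real (Set.Ioi y) = (1 - ε) * pValue y + ε * pValue (y - μ) := by
  rw [mixture, Measure.real, Measure.add_apply, Measure.smul_apply, Measure.smul_apply,
    smul_eq_mul, smul_eq_mul,
    ENNReal.toReal_add (ENNReal.mul_ne_top ENNReal.ofReal_ne_top (measure_ne_top _ _))
      (ENNReal.mul_ne_top ENNReal.ofReal_ne_top (measure_ne_top _ _)),
    ENNReal.toReal_mul, ENNReal.toReal_mul, ENNReal.toReal_ofReal (by linarith),
    ENNReal.toReal_ofReal h0]
  rw [← gaussianReal_real_Ioi μ y]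
  rfl

/-- The squared likelihood ratio of `N(μ, 1)` is `exp (μ²)` times that of `N(2μ, 1)`. -/
theorem integral_exp_Iic (μ τ : ℝ) :
    ∫⁻ x in Set.Iic τ, ENNReal.ofReal (Real.exp (2 * μ * x - μ ^ 2)) ∂(gaussianReal 0 1) =
      ENNReal.ofReal (Real.exp (μ ^ 2) * pValue (2 * μ - τ)) := by
  have h : ∀ x, ENNReal.ofReal (Real.exp (2 * μ * x - μ ^ 2)) = ENNReal.ofReal (Real.exp (μ ^ 2)) *
      ENNReal.ofReal (Real.exp (2 * μ * x - (2 * μ) ^ 2 / 2)) := fun x => by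
    rw [← ENNReal.ofReal_mul (Real.exp_nonneg _), ← Real.exp_add]
    ring_nf
  simp_rw [h]
  rw [lintegral_const_mul _ (by fun_prop), ← withDensity_apply _ measurableSet_Iic,
    ← gaussianReal_eq_withDensity, ENNReal.ofReal_mul (Real.exp_nonneg _),
    ← gaussianReal_real_Iic, ofReal_measureReal]

/-- The truncated second moment of the likelihood ratio. -/
theorem lintegral_sq_mixtureDensity_le {ε : ℝ} (h0 : 0 ≤ ε) (h1 : ε ≤ 1) (μ τ : ℝ) :
    ∫⁻ x, (Set.Iic τ).indicator (fun x => ENNReal.ofReal (mixtureDensity ε μ x)) x ^ 2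
      ∂(gaussianReal 0 1) ≤
      ENNReal.ofReal (1 + ε ^ 2 * (Real.exp (μ ^ 2) * pValue (2 * μ - τ))) := by
  -- Truncation matters only in the quadratic term; the others are integrated over the whole line
  -- and contribute `(1 - ε)² + 2ε(1 - ε) ≤ 1`.
  have hb : ∀ x, (Set.Iic τ).indicator (fun x => ENNReal.ofReal (mixtureDensity ε μ x)) x ^ 2 ≤
      (ENNReal.ofReal ((1 - ε) ^ 2) + ENNReal.ofReal (2 * ε * (1 - ε)) *
        ENNReal.ofReal (Real.exp (μ * x - μ ^ 2 / 2))) + ENNReal.ofReal (ε ^ 2) *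
        (Set.Iic τ).indicator (fun x => ENNReal.ofReal (Real.exp (2 * μ * x - μ ^ 2))) x := by
    intro x
    by_cases hx : x ∈ Set.Iic τ
    · have hε : 0 ≤ 1 - ε := by linarith
      rw [Set.indicator_of_mem hx, Set.indicator_of_mem hx,
        ← ENNReal.ofReal_pow (by unfold mixtureDensity; positivity),
        ← ENNReal.ofReal_mul (by positivity), ← ENNReal.ofReal_mul (by positivity),
        ← ENNReal.ofReal_add (by positivity) (by positivity),
        ← ENNReal.ofReal_add (by positivity) (by positivity)]
      refine ENNReal.ofReal_le_ofReal (le_of_eq ?_)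
      have h : Real.exp (2 * μ * x - μ ^ 2) = Real.exp (μ * x - μ ^ 2 / 2) ^ 2 := by
        rw [← Real.exp_nat_mul]; push_cast; ring_nf
      rw [h, mixtureDensity]
      ring
    · rw [Set.indicator_of_notMem hx]; simp
  have hε : 0 ≤ 1 - ε := by linarith
  have hone : ∫⁻ x, ENNReal.ofReal (Real.exp (μ * x - μ ^ 2 / 2)) ∂(gaussianReal 0 1) = 1 := by
    rw [← setLIntegral_univ, ← withDensity_apply _ .univ, ← gaussianReal_eq_withDensity,
      measure_univ]
  have hp := (pValue_pos (2 * μ - τ)).le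
  calc _ ≤ _ := lintegral_mono hb
    _ = ENNReal.ofReal ((1 - ε) ^ 2 + 2 * ε * (1 - ε) +
          ε ^ 2 * (Real.exp (μ ^ 2) * pValue (2 * μ - τ))) := by
      rw [lintegral_add_left (by fun_prop), lintegral_add_left (by fun_prop), lintegral_const,
        lintegral_const_mul _ (by fun_prop), hone, measure_univ,
        lintegral_const_mul _ (Measurable.indicator (by fun_prop) measurableSet_Iic),
        lintegral_indicator measurableSet_Iic, integral_exp_Iic, mul_one, mul_one,
        ← ENNReal.ofReal_mul (by positivity), ← ENNReal.ofReal_add (by positivity) (by positivity),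
        ← ENNReal.ofReal_add (by positivity) (by positivity)]
    _ ≤ _ := by
      refine ENNReal.ofReal_le_ofReal ?_
      nlinarith [sq_nonneg ε]

/-- A second moment bound, with truncation, for the probability of an event under i.i.d.
observations with density `g` with respect to `μ`. -/
theorem pi_withDensity_le {Ω : Type*} [MeasurableSpace Ω] {n : ℕ} (μ : Measure Ω)
    [IsProbabilityMeasure μ] {g : Ω → ENNReal} (hg : Measurable g)
    [IsProbabilityMeasure (μ.withDensity g)] {S : Set Ω} (hS : MeasurableSet S)
    (A : Set (Fin n → Ω)) {c : ENNReal} (hc0 : c ≠ 0) (hc : c ≠ ⊤) :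
    Measure.pi (fun _ : Fin n => μ.withDensity g) A ≤
      c * Measure.pi (fun _ : Fin n => μ) A + c⁻¹ * (∫⁻ u, S.indicator g u ^ 2 ∂μ) ^ n +
        n * μ.withDensity g Sᶜ := by
  set P := Measure.pi fun _ : Fin n => μ with hP
  set Q := Measure.pi fun _ : Fin n => μ.withDensity g with hQ
  -- The event `A` is arbitrary, so it is replaced by a measurable hull of the same null
  -- probability.
  set A' := toMeasurable P A
  have hA' : MeasurableSet A' := measurableSet_toMeasurable P A
  have hSn : MeasurableSet (Set.univ.pi fun _ : Fin n => S) := MeasurableSet.univ_pi fun _ => hS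
  let L : (Fin n → Ω) → ENNReal := fun x => ∏ j, S.indicator g (x j)
  have hcover : A ⊆ (A' ∩ Set.univ.pi fun _ => S) ∪ ⋃ j, {x | x j ∈ Sᶜ} := by
    intro x hx
    by_cases h : ∀ j, x j ∈ S
    · exact Or.inl ⟨subset_toMeasurable P A hx, fun j _ => h j⟩
    · push Not at h
      exact Or.inr (Set.mem_iUnion.mpr h)
  have hleft : Q (A' ∩ Set.univ.pi fun _ => S) ≤
      c * P A + c⁻¹ * (∫⁻ u, S.indicator g u ^ 2 ∂μ) ^ n := by
    calc Q (A' ∩ Set.univ.pi fun _ => S)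
        = ∫⁻ x in A' ∩ Set.univ.pi fun _ => S, ∏ j, g (x j) ∂P := by
          rw [hQ, pi_withDensity μ hg, withDensity_apply _ (hA'.inter hSn)]
      -- Pointwise `L ≤ c + L² / c`, according to whether `L ≤ c`.
      _ ≤ ∫⁻ x in A' ∩ Set.univ.pi fun _ => S, c + c⁻¹ * L x ^ 2 ∂P := by
          refine setLIntegral_mono' (hA'.inter hSn) fun x hx => ?_
          have : ∏ j, g (x j) = L x :=
            Finset.prod_congr rfl fun j hj => (Set.indicator_of_mem (hx.2 j (Set.mem_univ j)) g).symm
          rw [this]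
          rcases le_total (L x) c with h | h
          · exact h.trans le_self_add
          · calc L x = c⁻¹ * (c * L x) := by rw [← mul_assoc, ENNReal.inv_mul_cancel hc0 hc, one_mul]
              _ ≤ c⁻¹ * L x ^ 2 := by rw [sq]; gcongr
              _ ≤ _ := le_add_self
      _ = c * P (A' ∩ Set.univ.pi fun _ => S) +
            ∫⁻ x in A' ∩ Set.univ.pi fun _ => S, c⁻¹ * L x ^ 2 ∂P := by
          rw [lintegral_add_left measurable_const, setLIntegral_const]
      _ ≤ c * P A + ∫⁻ x, c⁻¹ * L x ^ 2 ∂P := by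
          refine add_le_add ?_ (setLIntegral_le_lintegral _ _)
          exact mul_le_mul' le_rfl
            ((measure_mono Set.inter_subset_left).trans_eq (measure_toMeasurable A))
      _ = c * P A + c⁻¹ * (∫⁻ u, S.indicator g u ^ 2 ∂μ) ^ n := by
          have hm : Measurable fun u => S.indicator g u ^ 2 := (hg.indicator hS).pow_const 2
          rw [lintegral_const_mul' _ _ (ENNReal.inv_ne_top.mpr hc0)]
          simp_rw [L, ← Finset.prod_pow]
          rw [hP, lintegral_pi_prod μ fun _ => hm]
          simp
  have hright : Q (⋃ j, {x | x j ∈ Sᶜ}) ≤ n * μ.withDensity g Sᶜ := by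
    calc Q (⋃ j, {x | x j ∈ Sᶜ}) ≤ ∑ j, Q {x | x j ∈ Sᶜ} := measure_iUnion_fintype_le _ _
      _ = ∑ _j : Fin n, μ.withDensity g Sᶜ := Finset.sum_congr rfl fun j _ =>
          (measurePreserving_eval (fun _ : Fin n => μ.withDensity g) j).measure_preimage
            hS.compl.nullMeasurableSet
      _ = n * μ.withDensity g Sᶜ := by simp
  exact (measure_mono hcover).trans ((measure_union_le _ _).trans (add_le_add hleft hright))

theorem pi_mixture_real_le {n : ℕ} {ε : ℝ} (h0 : 0 ≤ ε) (h1 : ε ≤ 1) (μ τ : ℝ)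
    (A : Set (Fin n → ℝ)) {c : ℝ} (hc : 0 < c) :
    (Measure.pi fun _ : Fin n => mixture ε μ).real A ≤
      c * (nullLaw n).real A +
        c⁻¹ * (1 + ε ^ 2 * (Real.exp (μ ^ 2) * pValue (2 * μ - τ))) ^ n +
        n * (mixture ε μ).real (Set.Ioi τ) := by
  have hprob := isProbabilityMeasure_mixture h0 h1 μ
  have hm := pValue_pos (2 * μ - τ)
  have hmeas := (measurable_mixtureDensity ε μ).ennreal_ofReal
  have h := mixture_eq_withDensity h0 h1 μ
  have hprob' : IsProbabilityMeasure
      ((gaussianReal 0 1).withDensity fun x => ENNReal.ofReal (mixtureDensity ε μ x)) := h ▸ hprob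
  have key := pi_withDensity_le (gaussianReal 0 1) hmeas (measurableSet_Iic (a := τ)) A
    (c := ENNReal.ofReal c) (by simpa using hc) ENNReal.ofReal_ne_top
  rw [← h, Set.compl_Iic] at key
  have hpow := pow_le_pow_left' (lintegral_sq_mixtureDensity_le h0 h1 μ τ) n
  have hnull : Measure.pi (fun _ : Fin n => gaussianReal 0 1) A =
      ENNReal.ofReal ((nullLaw n).real A) := by
    rw [ofReal_measureReal (by rw [nullLaw]; exact measure_ne_top _ _), nullLaw]
  have hn0 : 0 ≤ (nullLaw n).real A := measureReal_nonneg
  have hi0 : 0 ≤ (mixture ε μ).real (Set.Ioi τ) := measureReal_nonneg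
  refine ENNReal.toReal_le_of_le_ofReal (by positivity) (key.trans ?_)
  rw [ENNReal.ofReal_add (by positivity) (by positivity),
    ENNReal.ofReal_add (by positivity) (by positivity), ENNReal.ofReal_mul hc.le,
    ENNReal.ofReal_mul (by positivity), ENNReal.ofReal_mul (by positivity),
    ENNReal.ofReal_pow (by positivity), ENNReal.ofReal_natCast, ofReal_measureReal (μ := mixture ε μ), ← hnull,
    ENNReal.ofReal_inv_of_pos hc]
  gcongr

/-- These are the exponent conditions of the lower bound, with `w = √r`. The second controls the
tail beyond `√(2 log n)`, and the truncated moment if `w > 1/2`; the third controls the moment if `w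
≤ 1/2`. -/
theorem le_of_lt_rhoStar {β w : ℝ} (hβ0 : 1 / 2 < β) (hβ1 : β < 1) (hw : 0 ≤ w)
    (h : w ^ 2 < rhoStar β) :
    w < 1 ∧ 1 - β ≤ (1 - w) ^ 2 ∧ (w ≤ 1 / 2 → 1 - 2 * β + 2 * w ^ 2 ≤ 0) := by
  unfold rhoStar at h
  split_ifs at h with hβ
  · have hw2 : w < 1 / 2 := by nlinarith
    exact ⟨by linarith, by nlinarith [sq_nonneg (w - 1 / 2)], fun _ => by linarith⟩
  · have hv : √(1 - β) ^ 2 = 1 - β := Real.sq_sqrt (by linarith)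
    have hv0 : 0 < √(1 - β) := Real.sqrt_pos.mpr (by linarith)
    have hv1 : √(1 - β) < 1 := by nlinarith
    have hw1 : w < 1 - √(1 - β) := lt_of_pow_lt_pow_left₀ 2 (by linarith) h
    exact ⟨by linarith, by nlinarith, fun hw2 => by nlinarith⟩

theorem tendsto_sqrt_two_mul_log : Tendsto (fun n : ℕ => √(2 * Real.log n)) atTop atTop :=
  Real.tendsto_sqrt_atTop.comp
    ((Real.tendsto_log_atTop.comp tendsto_natCast_atTop_atTop).const_mul_atTop two_pos)

theorem pow_neg_mem {β : ℝ} (hβ : 0 < β) {n : ℕ} (hn : 1 ≤ n) :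
    0 ≤ (n : ℝ) ^ (-β) ∧ (n : ℝ) ^ (-β) ≤ 1 :=
  ⟨by positivity, Real.rpow_le_one_of_one_le_of_nonpos (by exact_mod_cast hn) (by linarith)⟩

/-- Below the detection boundary the Berk–Jones test is powerless, because every test is. -/
theorem power_tendsto_zero {β r : ℝ} (hβ0 : 1 / 2 < β) (hβ1 : β < 1) (hr : 0 < r)
    (h : r < rhoStar β) {α b : ℕ → ℝ} (hα : Tendsto α atTop (𝓝 0))
    (hcrit : ∀ n, IsCriticalValue n (α n) (b n)) :
    Tendsto (fun n => power β r n (b n)) atTop (𝓝 0) := by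
  set w := √r with hw
  have hw0 : 0 < w := Real.sqrt_pos.mpr hr
  have hwr : w ^ 2 = r := Real.sq_sqrt hr.le
  obtain ⟨hw1, hc1, hc2⟩ := le_of_lt_rhoStar hβ0 hβ1 hw0.le (hwr ▸ h)
  have hτ := tendsto_sqrt_two_mul_log
  have hbase : ∀ n : ℕ, 1 ≤ n → (n : ℝ) = Real.exp (√(2 * Real.log n) ^ 2 / 2) ∧
      (n : ℝ) ^ (-β) = Real.exp (-β * (√(2 * Real.log n) ^ 2 / 2)) ∧
      √(2 * r * Real.log n) = w * √(2 * Real.log n) := by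
    intro n hn
    have hn' : (0 : ℝ) < n := by exact_mod_cast hn
    have hl : √(2 * Real.log n) ^ 2 / 2 = Real.log n := by
      rw [Real.sq_sqrt (mul_nonneg two_pos.le (Real.log_natCast_nonneg n))]; ring
    refine ⟨by rw [hl, Real.exp_log hn'], by rw [hl, Real.rpow_def_of_pos hn', mul_comm], ?_⟩
    rw [hw, ← Real.sqrt_mul hr.le]
    ring_nf
  have hmoment : ∀ᶠ n : ℕ in atTop, n * (((n : ℝ) ^ (-β)) ^ 2 *
      (Real.exp (√(2 * r * Real.log n) ^ 2) *
        pValue (2 * √(2 * r * Real.log n) - √(2 * Real.log n)))) ≤ 1 := by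
    -- For `w ≤ 1/2` the tail argument `2μ - τ` is not positive, so truncation gains nothing and the
    -- tail is bounded by `1`; otherwise Mills' bound applies.
    rcases le_or_gt w (1 / 2) with hle | hgt
    · filter_upwards [eventually_ge_atTop 1] with n hn
      obtain ⟨e1, e2, e3⟩ := hbase n hn
      rw [e2, e3]
      nth_rewrite 1 [e1]
      set τ := √(2 * Real.log n)
      calc _ ≤ Real.exp (τ ^ 2 / 2) * (Real.exp (-β * (τ ^ 2 / 2)) ^ 2 *
            (Real.exp ((w * τ) ^ 2) * 1)) := by
            gcongr
            exact (pValue_lt_one _).le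
        _ = Real.exp (τ ^ 2 / 2 * (1 - 2 * β + 2 * w ^ 2)) := by
            rw [mul_one, ← Real.exp_nat_mul, ← Real.exp_add, ← Real.exp_add]
            push_cast; ring_nf
        _ ≤ 1 := Real.exp_le_one_iff.mpr (mul_nonpos_of_nonneg_of_nonpos (by positivity) (hc2 hle))
    · have hy : Tendsto (fun n : ℕ => (2 * w - 1) * √(2 * Real.log n)) atTop atTop :=
        hτ.const_mul_atTop (by linarith)
      filter_upwards [eventually_ge_atTop 1, hy.eventually_ge_atTop 1] with n hn hy1
      obtain ⟨e1, e2, e3⟩ := hbase n hn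
      rw [e2, e3]
      nth_rewrite 1 [e1]
      set τ := √(2 * Real.log n)
      have e4 : 2 * (w * τ) - τ = (2 * w - 1) * τ := by ring
      calc _ ≤ Real.exp (τ ^ 2 / 2) * (Real.exp (-β * (τ ^ 2 / 2)) ^ 2 *
            (Real.exp ((w * τ) ^ 2) * Real.exp (-((2 * w - 1) * τ) ^ 2 / 2))) := by
            rw [e4]
            gcongr
            exact (pValue_le (by linarith)).trans (div_le_self (Real.exp_nonneg _) hy1)
        _ = Real.exp (τ ^ 2 / 2 * (2 * ((1 - β) - (1 - w) ^ 2))) := by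
            rw [← Real.exp_nat_mul, ← Real.exp_add, ← Real.exp_add, ← Real.exp_add]
            push_cast; ring_nf
        _ ≤ 1 := Real.exp_le_one_iff.mpr
            (mul_nonpos_of_nonneg_of_nonpos (by positivity) (by linarith))
  have htail : Tendsto (fun n : ℕ => n *
      (mixture ((n : ℝ) ^ (-β)) √(2 * r * Real.log n)).real (Set.Ioi √(2 * Real.log n)))
      atTop (𝓝 0) := by
    -- The exponents are only known to be nonpositive; convergence to `0` comes from the factor `1 /
    -- y` in `pValue_le`.
    have hlim : Tendsto (fun n : ℕ => (√(2 * Real.log n))⁻¹ + ((1 - w) * √(2 * Real.log n))⁻¹)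
        atTop (𝓝 0) := by
      simpa using hτ.inv_tendsto_atTop.add
        (hτ.const_mul_atTop (show 0 < 1 - w by linarith)).inv_tendsto_atTop
    refine squeeze_zero' (.of_forall fun n => by positivity) ?_ hlim
    filter_upwards [eventually_ge_atTop 1, hτ.eventually_gt_atTop 0] with n hn hτ0
    obtain ⟨hε0, hε1⟩ := pow_neg_mem (show 0 < β by linarith) hn
    rw [mixture_real_Ioi hε0 hε1]
    obtain ⟨e1, e2, e3⟩ := hbase n hn
    have e4 : √(2 * Real.log n) - √(2 * r * Real.log n) = (1 - w) * √(2 * Real.log n) := by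
      rw [e3]; ring
    rw [e4]
    set τ := √(2 * Real.log n)
    have hw1' : 0 < 1 - w := by linarith
    rw [mul_add]
    refine add_le_add ?_ ?_
    · calc (n : ℝ) * ((1 - (n : ℝ) ^ (-β)) * pValue τ) ≤
            Real.exp (τ ^ 2 / 2) * (1 * (Real.exp (-τ ^ 2 / 2) / τ)) := by
            rw [← e1]
            gcongr
            · exact (pValue_pos _).le
            · linarith
            · exact pValue_le hτ0
        _ = τ⁻¹ := by
            rw [one_mul, ← mul_div_assoc, ← Real.exp_add]; ring_nf; simp
    · calc (n : ℝ) * ((n : ℝ) ^ (-β) * pValue ((1 - w) * τ)) ≤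
            Real.exp (τ ^ 2 / 2) * (Real.exp (-β * (τ ^ 2 / 2)) *
              (Real.exp (-((1 - w) * τ) ^ 2 / 2) / ((1 - w) * τ))) := by
            rw [← e1, ← e2]
            gcongr
            exact pValue_le (by positivity)
        _ = Real.exp (τ ^ 2 / 2 * ((1 - β) - (1 - w) ^ 2)) / ((1 - w) * τ) := by
            rw [← mul_div_assoc, ← mul_div_assoc, ← Real.exp_add, ← Real.exp_add]
            ring_nf
        _ ≤ 1 / ((1 - w) * τ) := by
            gcongr
            exact Real.exp_le_one_iff.mpr
              (mul_nonpos_of_nonneg_of_nonpos (by positivity) (by linarith))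
        _ = ((1 - w) * τ)⁻¹ := one_div _
  have hbound : ∀ c : ℝ, 0 < c → ∀ᶠ n : ℕ in atTop, power β r n (b n) ≤
      c * α n + c⁻¹ * Real.exp 1 + n * (mixture ((n : ℝ) ^ (-β)) √(2 * r * Real.log n)).real
        (Set.Ioi √(2 * Real.log n)) := by
    intro c hc
    filter_upwards [eventually_ge_atTop 1, hmoment] with n hn hm
    obtain ⟨hε0, hε1⟩ := pow_neg_mem (show 0 < β by linarith) hn
    refine (pi_mixture_real_le hε0 hε1 √(2 * r * Real.log n) √(2 * Real.log n)
      (rejects n (b n)) hc).trans ?_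
    gcongr
    · exact hcrit n
    · set q := ((n : ℝ) ^ (-β)) ^ 2 * (Real.exp (√(2 * r * Real.log n) ^ 2) *
        pValue (2 * √(2 * r * Real.log n) - √(2 * Real.log n)))
      have hq : 0 ≤ q := by
        have := (pValue_pos (2 * √(2 * r * Real.log n) - √(2 * Real.log n))).le
        positivity
      calc (1 + q) ^ n ≤ Real.exp q ^ n := by
            gcongr
            linarith [Real.add_one_le_exp q]
        _ = Real.exp (n * q) := (Real.exp_nat_mul q n).symm
        _ ≤ Real.exp 1 := Real.exp_le_exp.mpr hm
  rw [Metric.tendsto_nhds]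
  intro δ hδ
  -- This `c` turns the second moment term `c⁻¹ * exp 1` into `δ / 2`.
  have hc : 0 < 2 * Real.exp 1 / δ := by positivity
  have hlim := (hα.const_mul (2 * Real.exp 1 / δ)).add htail
  simp only [mul_zero, add_zero] at hlim
  filter_upwards [hbound _ hc, hlim.eventually_lt_const (show 0 < δ / 2 by linarith)] with n h1 h2
  rw [Real.dist_eq, sub_zero, abs_of_nonneg (show 0 ≤ power β r n (b n) from measureReal_nonneg)]
  have e : (2 * Real.exp 1 / δ)⁻¹ * Real.exp 1 = δ / 2 := by field_simp
  rw [e] at h1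
  linarith

/-! ### Power above the boundary -/

open Classical in
/-- Chebyshev's inequality for the number of observations in a set. -/
theorem pi_real_card_le {Ω : Type*} [MeasurableSpace Ω] {n : ℕ} (μ : Measure Ω)
    [IsProbabilityMeasure μ] {S : Set Ω} (hS : MeasurableSet S) {d : ℝ} (hd : 0 < d) :
    (Measure.pi fun _ : Fin n => μ).real
      {ω | ((Finset.univ.filter fun j => ω j ∈ S).card : ℝ) ≤ n * μ.real S - d} ≤
      n * μ.real S / d ^ 2 := by
  let f : Ω → ℝ := S.indicator 1
  have hf : MemLp f 2 μ := memLp_indicator_const 2 hS 1 (Or.inr (measure_ne_top _ _))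
  have hmean : ∫ u, f u ∂μ = μ.real S := integral_indicator_one hS
  have hvar : Var[f; μ] ≤ μ.real S := by
    refine (variance_le_expectation_sq hf.aestronglyMeasurable).trans_eq ?_
    rw [← hmean]
    refine integral_congr_ae (.of_forall fun u => ?_)
    by_cases hu : u ∈ S <;> simp [f, hu]
  let F : (Fin n → Ω) → ℝ := ∑ j, fun ω => f (ω j)
  have hfj : ∀ j : Fin n, MemLp (fun ω : Fin n → Ω => f (ω j)) 2 (Measure.pi fun _ => μ) :=
    fun j => hf.comp_measurePreserving (measurePreserving_eval (fun _ : Fin n => μ) j)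
  have hF : MemLp F 2 (Measure.pi fun _ : Fin n => μ) := memLp_finsetSum' _ fun j _ => hfj j
  have hFvar : Var[F; Measure.pi fun _ : Fin n => μ] ≤ n * μ.real S := by
    have : Var[F; Measure.pi fun _ : Fin n => μ] = ∑ _j : Fin n, Var[f; μ] :=
      variance_sum_pi (μ := fun _ : Fin n => μ) (X := fun _ => f) fun _ => hf
    rw [this, Finset.sum_const, Finset.card_univ, Fintype.card_fin, nsmul_eq_mul]
    gcongr
  have hFmean : ∫ ω, F ω ∂(Measure.pi fun _ : Fin n => μ) = n * μ.real S := by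
    simp only [F, Finset.sum_apply]
    rw [integral_finsetSum _ fun j _ => (hfj j).integrable (by norm_num)]
    have : ∀ j : Fin n, ∫ ω, f (ω j) ∂(Measure.pi fun _ : Fin n => μ) = μ.real S := fun j => by
      rw [← hmean]
      exact integral_comp_eval (μ := fun _ : Fin n => μ) (i := j) hf.aestronglyMeasurable
    simp [this]
  have hcard : ∀ ω : Fin n → Ω, F ω = (Finset.univ.filter fun j => ω j ∈ S).card := by
    intro ω
    simp only [F, f, Finset.sum_apply, Set.indicator_apply, Pi.one_apply, Finset.sum_boole]
  refine ENNReal.toReal_le_of_le_ofReal (by positivity) ?_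
  refine (measure_mono fun ω hω => ?_).trans
    ((meas_ge_le_variance_div_sq hF hd).trans (ENNReal.ofReal_le_ofReal (by gcongr)))
  have h1 : ((Finset.univ.filter fun j => ω j ∈ S).card : ℝ) ≤ n * μ.real S - d := hω
  show d ≤ |F ω - ∫ ω, F ω ∂(Measure.pi fun _ : Fin n => μ)|
  rw [hFmean, hcard, abs_sub_comm]
  exact le_trans (by linarith) (le_abs_self _)

/-- A lower bound on the power of the Berk–Jones test, from the excess `D` of the expected number
of observations beyond `τ` over its value `A` under the null hypothesis. -/
theorem one_sub_le_pi_mixture_rejects {n : ℕ} {ε : ℝ} (h0 : 0 ≤ ε) (h1 : ε ≤ 1) {μ τ b A D : ℝ}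
    (hA : A = n * pValue τ) (hD : D = n * (ε * (pValue (τ - μ) - pValue τ)))
    (hD2 : 2 ≤ D) (hAD : A + D ≤ n / 2) (hb : b < D ^ 2 / (8 * (A + D))) :
    1 - 4 * (A + D) / D ^ 2 ≤ (Measure.pi fun _ : Fin n => mixture ε μ).real (rejects n b) := by
  classical
  have hprob := isProbabilityMeasure_mixture h0 h1 μ
  have hA0 : 0 ≤ A := by rw [hA]; have := (pValue_pos τ).le; positivity
  have hn : (0 : ℝ) < n := by linarith
  have hq : n * (mixture ε μ).real (Set.Ioi τ) = A + D := by
    rw [mixture_real_Ioi h0 h1, hA, hD]; ring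
  set P := Measure.pi fun _ : Fin n => mixture ε μ
  have hcheb := pi_real_card_le (n := n) (mixture ε μ) (measurableSet_Ioi (a := τ))
    (show 0 < D / 2 by linarith)
  rw [hq] at hcheb
  set bad : Set (Fin n → ℝ) :=
    {ω | ((Finset.univ.filter fun j => ω j ∈ Set.Ioi τ).card : ℝ) ≤ A + D - D / 2}
  -- The statistic is evaluated at an index halfway between the expected counts `A` and `A + D`; `D
  -- ≥ 2` leaves room for rounding up. In `Fin n` this index is `m - 1`.
  set m := ⌈A + D / 2⌉₊ with hm
  have hm0 : 0 < m := Nat.ceil_pos.mpr (by linarith)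
  have hm1 : A + D / 2 ≤ m := Nat.le_ceil _
  have hm2 : (m : ℝ) ≤ A + D := by
    have := Nat.ceil_lt_add_one (show 0 ≤ A + D / 2 by linarith)
    linarith
  have hmn : m ≤ n := by
    have : (m : ℝ) ≤ n := by linarith
    exact_mod_cast this
  let i : Fin n := ⟨m - 1, by omega⟩
  have hi1 : (i : ℕ) + 1 = m := by simp only [i]; omega
  have hi : (i : ℝ) + 1 = m := by exact_mod_cast hi1
  have hgood : badᶜ ⊆ rejects n b := by
    intro ω hω
    have hω' : A + D - D / 2 < ((Finset.univ.filter fun j => ω j ∈ Set.Ioi τ).card : ℝ) :=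
      not_le.mp hω
    have hcount : (i : ℕ) + 1 ≤
        (Finset.univ.filter fun j => pValue (ω j) ≤ pValue τ).card := by
      rw [hi1]
      refine (Nat.ceil_le.mpr (show A + D / 2 ≤ _ by linarith)).trans
        (Finset.card_le_card (s := Finset.univ.filter fun j => ω j ∈ Set.Ioi τ) fun j hj => ?_)
      rw [Finset.mem_filter] at hj ⊢
      exact ⟨hj.1, pValue_strictAnti.antitone (le_of_lt hj.2)⟩
    have hord := orderStat_le_of_succ_le_card hcount
    have hlt : pValue τ < ((i : ℝ) + 1) / n := by
      rw [hi, lt_div_iff₀ hn, mul_comm, ← hA]; linarith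
    have ht1 : ((i : ℝ) + 1) / n < 1 := by
      rw [hi, div_lt_one hn]; linarith
    refine mem_rejects_of_lt i (by rw [hi]; linarith) (hord.trans_lt hlt) (hb.trans_le ?_)
    calc D ^ 2 / (8 * (A + D)) = (D / 2) ^ 2 / (2 * (A + D)) := by field_simp; norm_num
      _ ≤ (m - A) ^ 2 / (2 * m) := by
          gcongr
          linarith
      _ = n * ((((i : ℝ) + 1) / n - pValue τ) ^ 2 / (2 * (((i : ℝ) + 1) / n))) := by
          rw [hi, hA]
          have : (0 : ℝ) < m := by exact_mod_cast hm0
          field_simp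
      _ ≤ n * bernoulliKL (((i : ℝ) + 1) / n) (pValue τ) := by
          gcongr
          exact sq_div_le_bernoulliKL (pValue_pos τ) hlt ht1
      _ ≤ _ := by
          gcongr
          exact bernoulliKL_le_of_le (pValue_pos _) hord hlt ht1
  have huniv : 1 ≤ P.real bad + P.real badᶜ := by
    rw [← probReal_univ (μ := P), ← Set.union_compl_self bad]
    exact measureReal_union_le _ _
  have hmono : P.real badᶜ ≤ P.real (rejects n b) := measureReal_mono hgood
  have e : (A + D) / (D / 2) ^ 2 = 4 * (A + D) / D ^ 2 := by field_simp; norm_num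
  rw [e] at hcheb
  have hbad : P.real bad ≤ 4 * (A + D) / D ^ 2 := hcheb
  linarith

/-- Above the boundary some level `n ^ (-σ²)` of the p-values exhibits a polynomial excess. -/
theorem exists_level_of_rhoStar_lt {β w : ℝ} (hβ0 : 1 / 2 < β) (hβ1 : β < 1) (hw : 0 < w)
    (h : rhoStar β < w ^ 2) :
    ∃ σ u : ℝ, 0 < σ ∧ σ ≤ 1 ∧ 0 ≤ u ∧ σ - w ≤ u ∧ u < σ ∧
      (1 - σ ^ 2) / 2 < 1 - β - u ^ 2 := by
  have hv : √(1 - β) ^ 2 = 1 - β := Real.sq_sqrt (by linarith)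
  have hv0 : 0 < √(1 - β) := Real.sqrt_pos.mpr (by linarith)
  unfold rhoStar at h
  -- The gap `1 - β - (σ - w)² - (1 - σ²) / 2` is maximal at `σ = 2w`, with value `w² - (β - 1/2)`.
  -- Once `2w ≥ 1` the constraint `σ ≤ 1` makes `σ = 1` optimal.
  rcases lt_or_ge w (1 / 2) with hlt | hge
  · have hβ : β ≤ 3 / 4 := by
      by_contra hcon
      rw [if_neg hcon] at h
      have : 1 - √(1 - β) < w := lt_of_pow_lt_pow_left₀ 2 hw.le h
      nlinarith
    rw [if_pos hβ] at h
    exact ⟨2 * w, w, by linarith, by linarith, hw.le, by linarith, by linarith, by nlinarith⟩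
  · have hu : max (1 - w) 0 < √(1 - β) := by
      refine max_lt ?_ hv0
      split_ifs at h with hβ
      · by_contra hcon
        rw [not_lt] at hcon
        have h1 : 1 - β ≤ (1 - w) ^ 2 := by rw [← hv]; gcongr
        have h2 : 1 / 2 ≤ √(1 - β) := Real.le_sqrt_of_sq_le (by linarith)
        have h3 : w = 1 / 2 := by linarith
        rw [h3] at h h1
        linarith
      · have := lt_of_pow_lt_pow_left₀ 2 hw.le h
        linarith
    refine ⟨1, max (1 - w) 0, one_pos, le_rfl, le_max_right _ _, le_max_left _ _,
      max_lt (by linarith) one_pos, ?_⟩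
    have : max (1 - w) 0 ^ 2 < √(1 - β) ^ 2 := by
      have := le_max_right (1 - w) 0
      gcongr
    linarith

/-- A surplus `g` in the quadratic exponent absorbs the lower order terms of `-(uT + 1)² / 2` left
by `le_pValue`. -/
theorem tendsto_exp_quadratic {g u : ℝ} (hg : 0 < g) :
    Tendsto (fun T : ℝ => Real.exp (g * (T ^ 2 / 2) - u * T - 1 / 2)) atTop atTop := by
  refine Real.tendsto_exp_atTop.comp ?_
  have h1 : Tendsto (fun T : ℝ => T * (g / 2 * T - u)) atTop atTop :=
    tendsto_id.atTop_mul_atTop₀ (tendsto_atTop_add_const_right _ (-u)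
      (tendsto_id.const_mul_atTop (by positivity)))
  refine (tendsto_atTop_add_const_right _ (-(1 / 2)) h1).congr fun T => ?_
  ring

/-- The gap between tail probabilities is of polynomial order. -/
theorem eventually_le_pValue_sub {σ u w g : ℝ} (hσ : 0 < σ) (hu : 0 ≤ u) (hσw : σ - w ≤ u)
    (huσ : u < σ) (hg : 0 < g) :
    ∀ᶠ T : ℝ in atTop, Real.exp (-(u ^ 2 + g) * (T ^ 2 / 2)) ≤
      pValue (σ * T - w * T) - pValue (σ * T) := by
  -- Capping `g` lets the same exponential bound the subtracted tail from above, while the shifted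
  -- tail is at least twice that exponential.
  set g' := min g (σ ^ 2 - u ^ 2) with hg'
  have hg'0 : 0 < g' := lt_min hg (by nlinarith)
  have hc : 0 < √(2 * Real.pi) := Real.sqrt_pos.mpr (by positivity)
  filter_upwards [(tendsto_exp_quadratic (u := u) hg'0).eventually_ge_atTop (2 * √(2 * Real.pi)),
    eventually_ge_atTop 0, (tendsto_id.const_mul_atTop hσ).eventually_ge_atTop 1] with T h1 hT h2
  simp only [id] at h2
  have hx : pValue (σ * T) ≤ Real.exp (-(u ^ 2 + g') * (T ^ 2 / 2)) := by
    refine (pValue_le (by linarith)).trans ((div_le_self (Real.exp_nonneg _) h2).trans ?_)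
    rw [Real.exp_le_exp]
    have : g' ≤ σ ^ 2 - u ^ 2 := min_le_right _ _
    have : (u ^ 2 + g') * (T ^ 2 / 2) ≤ σ ^ 2 * (T ^ 2 / 2) := by gcongr; linarith
    linarith
  have hy : 2 * Real.exp (-(u ^ 2 + g') * (T ^ 2 / 2)) ≤ pValue (σ * T - w * T) := by
    calc 2 * Real.exp (-(u ^ 2 + g') * (T ^ 2 / 2))
        = (√(2 * Real.pi))⁻¹ * (2 * √(2 * Real.pi)) * Real.exp (-(u ^ 2 + g') * (T ^ 2 / 2)) := by
          field_simp
      _ ≤ (√(2 * Real.pi))⁻¹ * Real.exp (g' * (T ^ 2 / 2) - u * T - 1 / 2) *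
            Real.exp (-(u ^ 2 + g') * (T ^ 2 / 2)) := by gcongr
      _ = (√(2 * Real.pi))⁻¹ * Real.exp (-(u * T + 1) ^ 2 / 2) := by
          rw [mul_assoc, ← Real.exp_add]; ring_nf
      _ ≤ pValue (u * T) := le_pValue (by positivity)
      _ ≤ _ := pValue_strictAnti.antitone (by nlinarith)
  have hgg : Real.exp (-(u ^ 2 + g) * (T ^ 2 / 2)) ≤ Real.exp (-(u ^ 2 + g') * (T ^ 2 / 2)) := by
    rw [Real.exp_le_exp]
    have : g' ≤ g := min_le_left _ _
    have : (u ^ 2 + g') * (T ^ 2 / 2) ≤ (u ^ 2 + g) * (T ^ 2 / 2) := by gcongr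
    linarith
  linarith

theorem isLittleO_log_log_rpow {g : ℝ} (hg : 0 < g) :
    (fun n : ℕ => Real.log (Real.log n)) =o[atTop] fun n : ℕ => (n : ℝ) ^ g := by
  have h1 : (fun x : ℝ => Real.log (Real.log x)) =o[atTop] Real.log :=
    Real.isLittleO_log_id_atTop.comp_tendsto Real.tendsto_log_atTop
  exact (h1.trans (isLittleO_log_rpow_atTop hg)).comp_tendsto tendsto_natCast_atTop_atTop

/-- With `l = log n`, `(A + D) / D²` is at most `2 n^(-g)`. This one ratio controls both the
Chebyshev error and, inverted, the size of the statistic. -/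
theorem excess_bounds {A D q g l : ℝ} (hq : 0 ≤ q) (hg : 0 < g) (hl : 0 ≤ l)
    (hA : A ≤ Real.exp (q * l)) (hD : Real.exp ((q / 2 + g) * l) ≤ D) :
    Real.exp (g * l) ≤ D ∧ A + D ≤ 2 * Real.exp (-(g * l)) * D ^ 2 := by
  have hgl : 0 ≤ g * l := by positivity
  have hDg : Real.exp (g * l) ≤ D := by
    refine le_trans (Real.exp_le_exp.mpr ?_) hD
    gcongr
    linarith
  have hD0 : 0 < D := (Real.exp_pos _).trans_le hDg
  have hinv : Real.exp (-(g * l)) * Real.exp (g * l) = 1 := by rw [← Real.exp_add]; simp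
  have h1 : D ≤ Real.exp (-(g * l)) * D ^ 2 := by
    calc D = Real.exp (-(g * l)) * (Real.exp (g * l) * D) := by rw [← mul_assoc, hinv, one_mul]
      _ ≤ Real.exp (-(g * l)) * (D * D) := by gcongr
      _ = _ := by ring
  have h2 : A ≤ Real.exp (-(g * l)) * D ^ 2 := by
    calc A ≤ Real.exp (-(g * l)) * (Real.exp ((q / 2 + g) * l)) ^ 2 := by
          refine hA.trans ?_
          rw [← Real.exp_nat_mul, ← Real.exp_add, Real.exp_le_exp]
          push_cast
          linarith
      _ ≤ _ := by gcongr
  exact ⟨hDg, by linarith⟩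

/-- Above the detection boundary the power of the Berk–Jones test tends to `1`. -/
theorem power_tendsto_one {β r : ℝ} (hβ0 : 1 / 2 < β) (hβ1 : β < 1) (hr : 0 < r)
    (h : rhoStar β < r) {b : ℕ → ℝ}
    (hb : Asymptotics.IsEquivalent atTop b fun n : ℕ => Real.log (Real.log n)) :
    Tendsto (fun n => power β r n (b n)) atTop (𝓝 1) := by
  set w := √r with hw
  have hw0 : 0 < w := Real.sqrt_pos.mpr hr
  have hwr : w ^ 2 = r := Real.sq_sqrt hr.le
  obtain ⟨σ, u, hσ0, hσ1, hu, hσw, huσ, hγ⟩ := exists_level_of_rhoStar_lt hβ0 hβ1 hw0 (hwr ▸ h)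
  -- Half the available gap: one `g` is spent in `eventually_le_pValue_sub`, the other remains as
  -- the excess of `D` over `n^((1-σ²)/2)`.
  set g := (1 - β - u ^ 2 - (1 - σ ^ 2) / 2) / 2 with hg
  have hg0 : 0 < g := by rw [hg]; linarith
  have hτ := tendsto_sqrt_two_mul_log
  have hlog : Tendsto (fun n : ℕ => Real.log n) atTop atTop :=
    Real.tendsto_log_atTop.comp tendsto_natCast_atTop_atTop
  have hexp : ∀ c : ℝ, 0 < c → Tendsto (fun n : ℕ => Real.exp (c * Real.log n)) atTop atTop :=
    fun c hc => Real.tendsto_exp_atTop.comp (hlog.const_mul_atTop hc)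
  have hexp' : ∀ c : ℝ, 0 < c → Tendsto (fun n : ℕ => Real.exp (-(c * Real.log n))) atTop (𝓝 0) :=
    fun c hc => Real.tendsto_exp_neg_atTop_nhds_zero.comp (hlog.const_mul_atTop hc)
  -- Any constant below `1/16` would do, as `D² / (8 (A + D))` is at least `exp (g * log n) / 16`.
  have hbsmall : ∀ᶠ n : ℕ in atTop, b n ≤ 1 / 32 * Real.exp (g * Real.log n) := by
    have := (hb.isBigO.trans_isLittleO (isLittleO_log_log_rpow hg0)).def
      (show (0 : ℝ) < 1 / 32 by norm_num)
    filter_upwards [this, eventually_gt_atTop 0] with n hn hn0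
    have hn' : (0 : ℝ) < n := by exact_mod_cast hn0
    rw [Real.norm_eq_abs, Real.norm_eq_abs, abs_of_pos (Real.rpow_pos_of_pos hn' _),
      Real.rpow_def_of_pos hn', mul_comm (Real.log _)] at hn
    exact (le_abs_self _).trans hn
  -- This gives `A + D ≤ n / 2`, which keeps the chosen index in the range `i ≤ n / 2`.
  have hsmall : ∀ᶠ n : ℕ in atTop,
      Real.exp (-(σ ^ 2 * Real.log n)) + Real.exp (-(β * Real.log n)) ≤ 1 / 2 := by
    have := (hexp' (σ ^ 2) (by positivity)).add (hexp' β (by linarith))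
    rw [add_zero] at this
    exact this.eventually_le_const (by norm_num)
  have hlower : ∀ᶠ n : ℕ in atTop,
      1 - 8 * Real.exp (-(g * Real.log n)) ≤ power β r n (b n) := by
    filter_upwards [eventually_ge_atTop 1, hbsmall, hsmall,
      hτ.eventually (eventually_le_pValue_sub hσ0 hu hσw huσ hg0),
      (hτ.const_mul_atTop hσ0).eventually_ge_atTop 1,
      (hexp g hg0).eventually_ge_atTop 2] with n hn hbn hsm hgap hστ hg2
    have hn' : (0 : ℝ) < n := by exact_mod_cast hn
    obtain ⟨hε0, hε1⟩ := pow_neg_mem (show 0 < β by linarith) hn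
    set T := √(2 * Real.log n) with hT
    set l := Real.log n with hl
    have hl0 : 0 ≤ l := Real.log_natCast_nonneg n
    have hTl : T ^ 2 / 2 = l := by rw [hT, Real.sq_sqrt (by positivity)]; ring
    have hnl : (n : ℝ) = Real.exp l := (Real.exp_log hn').symm
    have hεl : (n : ℝ) ^ (-β) = Real.exp (-(β * l)) := by
      rw [Real.rpow_def_of_pos hn', ← hl]; ring_nf
    have hμ : √(2 * r * l) = w * T := by
      rw [hw, hT, ← Real.sqrt_mul hr.le]; ring_nf
    rw [hTl] at hgap
    set A := n * pValue (σ * T) with hA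
    set D := n * ((n : ℝ) ^ (-β) * (pValue (σ * T - √(2 * r * l)) - pValue (σ * T))) with hD
    have hx : pValue (σ * T) ≤ Real.exp (-(σ ^ 2 * l)) := by
      refine (pValue_le (by linarith)).trans ((div_le_self (Real.exp_nonneg _) hστ).trans_eq ?_)
      rw [← hTl]; ring_nf
    have hA0 : 0 < A := mul_pos hn' (pValue_pos _)
    have hA1 : A ≤ Real.exp ((1 - σ ^ 2) * l) := by
      calc A ≤ Real.exp l * Real.exp (-(σ ^ 2 * l)) := by rw [hA, ← hnl]; gcongr
        _ = _ := by rw [← Real.exp_add]; ring_nf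
    have hD1 : Real.exp (((1 - σ ^ 2) / 2 + g) * l) ≤ D := by
      calc Real.exp (((1 - σ ^ 2) / 2 + g) * l)
          = Real.exp l * (Real.exp (-(β * l)) * Real.exp (-(u ^ 2 + g) * l)) := by
            rw [← Real.exp_add, ← Real.exp_add, hg]; ring_nf
        _ ≤ D := by
            rw [hD, hεl, ← hnl, hμ]
            gcongr
    obtain ⟨hDg, hADD⟩ := excess_bounds (by nlinarith) hg0 hl0 hA1 hD1
    have hD0 : 0 < D := (Real.exp_pos _).trans_le hDg
    have hAD : A + D ≤ n / 2 := by
      have h1 : D ≤ n * (Real.exp (-(β * l)) * 1) := by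
        rw [hD, hεl]
        gcongr
        linarith [pValue_lt_one (σ * T - √(2 * r * l)), pValue_pos (σ * T)]
      have h2 : A ≤ n * Real.exp (-(σ ^ 2 * l)) := by rw [hA]; gcongr
      calc A + D ≤ n * (Real.exp (-(σ ^ 2 * l)) + Real.exp (-(β * l))) := by linarith
        _ ≤ n * (1 / 2) := by gcongr
        _ = n / 2 := by ring
    have hinv : Real.exp (g * l) * Real.exp (-(g * l)) = 1 := by rw [← Real.exp_add]; simp
    have hratio : 4 * (A + D) / D ^ 2 ≤ 8 * Real.exp (-(g * l)) := by
      rw [div_le_iff₀ (by positivity)]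
      linarith
    have hbD : b n < D ^ 2 / (8 * (A + D)) := by
      refine (hbn.trans_lt ?_).trans_le (show Real.exp (g * l) / 16 ≤ _ from ?_)
      · linarith [Real.exp_pos (g * l)]
      · rw [le_div_iff₀ (by positivity)]
        calc Real.exp (g * l) / 16 * (8 * (A + D))
            ≤ Real.exp (g * l) / 16 * (8 * (2 * Real.exp (-(g * l)) * D ^ 2)) := by gcongr
          _ = (Real.exp (g * l) * Real.exp (-(g * l))) * D ^ 2 := by ring
          _ = D ^ 2 := by rw [hinv, one_mul]
    have := one_sub_le_pi_mixture_rejects hε0 hε1 hA hD (hg2.trans hDg) hAD hbD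
    exact le_trans (by linarith) this
  have hupper : ∀ᶠ n : ℕ in atTop, power β r n (b n) ≤ 1 := by
    filter_upwards [eventually_ge_atTop 1] with n hn
    obtain ⟨hε0, hε1⟩ := pow_neg_mem (show 0 < β by linarith) hn
    have := isProbabilityMeasure_mixture hε0 hε1 √(2 * r * Real.log n)
    unfold power altLaw
    exact measureReal_le_one
  have hlim := ((hexp' g hg0).const_mul 8).const_sub 1
  simp only [mul_zero, sub_zero] at hlim
  exact tendsto_of_tendsto_of_tendsto_of_le_of_le' hlim tendsto_const_nhds hlower hupper

/-! ### Uniqueness of the detection boundary -/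

theorem rhoStar_pos {β : ℝ} (hβ0 : 1 / 2 < β) : 0 < rhoStar β := by
  unfold rhoStar
  split_ifs
  · linarith
  · have : √(1 - β) < 1 := by
      rw [Real.sqrt_lt' one_pos]; linarith
    have : 0 < 1 - √(1 - β) := by linarith
    positivity

theorem isDetectionBoundary_rhoStar {β : ℝ} (hβ0 : 1 / 2 < β) (hβ1 : β < 1) :
    IsDetectionBoundary β (rhoStar β) := fun _ _ hs _ hr =>
  ⟨fun h => power_tendsto_one hβ0 hβ1 hr h hs.equivalent,
    fun h => power_tendsto_zero hβ0 hβ1 hr h hs.level_tendsto hs.critical⟩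

/-- There is at most one positive detection boundary, as the power cannot tend both to `0` and
to `1`. -/
theorem IsDetectionBoundary.eq {β ρ ρ' : ℝ} (h : IsDetectionBoundary β ρ)
    (h' : IsDetectionBoundary β ρ') (hρ' : 0 < ρ') : ρ = ρ' := by
  obtain ⟨α, b, hs⟩ := exists_slowlyEnough
  rcases lt_trichotomy ρ ρ' with hlt | heq | hgt
  · obtain ⟨r, hr, hr'⟩ := exists_between (max_lt hlt hρ')
    have hr0 : 0 < r := (le_max_right _ _).trans_lt hr
    exact absurd (tendsto_nhds_unique ((h α b hs r hr0).1 ((le_max_left _ _).trans_lt hr))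
      ((h' α b hs r hr0).2 hr')) one_ne_zero
  · exact heq
  · obtain ⟨r, hr, hr'⟩ := exists_between hgt
    have hr0 : 0 < r := hρ'.trans hr
    exact absurd (tendsto_nhds_unique ((h' α b hs r hr0).1 hr)
      ((h α b hs r hr0).2 hr')) one_ne_zero

end BerkJones

theorem theorem1p6 :
    (∃ α b : ℕ → ℝ, BerkJones.SlowlyEnough α b) ∧
    ∀ β : ℝ, 1 / 2 < β → β < 1 →
      ∀ ρ : ℝ, BerkJones.IsDetectionBoundary β ρ ↔ ρ = BerkJones.rhoStar β := by
  refine ⟨BerkJones.exists_slowlyEnough, fun β hβ0 hβ1 ρ => ⟨fun h => ?_, ?_⟩⟩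
  · exact h.eq (BerkJones.isDetectionBoundary_rhoStar hβ0 hβ1) (BerkJones.rhoStar_pos hβ0)
  · rintro rfl
    exact BerkJones.isDetectionBoundary_rhoStar hβ0 hβ1
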